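/- \textbf{Setting.} Let $\mathfrak h$ be a complex Hilbert space (scalar product antilinear in the first entry) with an antiunitary involution $\Gamma$. Let $P$ be an orthogonal projection on $\mathfrak h$ with $P+\Gamma P\Gamma=1$ and range $\mathfrak p$, and let $\mathfrak q\subset\mathfrak h$ be a closed subspace with $\Gamma\mathfrak q\subset\mathfrak q$ and orthogonal projection $Q$. Assume that $\mathfrak p$ and $\mathfrak q$ are in generic position: $\mathfrak p\cap\mathfrak q=\mathfrak p\cap\mathfrak q^\perp=\mathfrak p^\perp\cap\mathfrak q=\mathfrak p^\perp\cap\mathfrak q^\perp=\{0\}$. Let $\mathfrak F=\bigoplus_{n\ge 0}\bigwedge^n\mathfrak p$ be the antisymmetric Fock space (Hilbert space direct sum of the completed exterior powers, with $\langle p_1\wedge\dots\wedge p_n,p_1'\wedge\dots\wedge p_n'\rangle=\det(\langle p_i,p_j'\rangle)$), with vacuum $\Omega$, creation operators $c(p)^*(p_1\wedge\dots\wedge p_n)=p\wedge p_1\wedge\dots\wedge p_n$ and their adjoints $c(p)$. Let $P_n$ be the projection of $\mathfrak F$ onto the $n$-particle subspace $\bigwedge^n\mathfrak p$, put $a(f)=c(P\Gamma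 f)^*+c(Pf)$ for $f\in\mathfrak h$, and let $\mathcal M(\mathfrak q)=\{a(q)\mid q\in\mathfrak q\}''$. Let $\beta$ be the antilinear operator on $\mathfrak p$ with graph $\{(Pq,P\Gamma q)\mid q\in\mathfrak q\}$, and $\Delta_{\mathfrak p}=\beta^*\beta$. \textbf{Theorem.} The vacuum $\Omega$ is cyclic and separating for $\mathcal M(\mathfrak q)$. Let $S$ be the Tomita operator, i.e. the closure of $A\Omega\mapsto A^*\Omega$ ($A\in\mathcal M(\mathfrak q)$), let $\Delta=S^*S$ be the modular operator, and let $S=J\Delta^{1/2}$ be the unique polar decomposition of $S$ with $J$ antiunitary and $\Delta^{1/2}$ positive self-adjoint. Then $\Delta$ and $J$ can be restricted to the $n$-particle subspaces for every $n\ge 0$: if $\psi\in\operatorname{dom}\Delta$ then $P_n\psi\in\operatorname{dom}\Delta$ and $\Delta P_n\psi=P_n\Delta\psi$, and $JP_n=P_nJ$. Moreover: (i) The restriction of $\Delta$ to the one-particle subspace $\mathfrak p$ is exactly $\Delta_{\mathfrak p}$ (including domains), and $\operatorname{dom}\Delta_{\mathfrak p}=PQ\mathfrak p$. For all $n$ and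 all $p_1,\dots,p_n\in\operatorname{dom}\Delta_{\mathfrak p}$, the vector $p_1\wedge\dots\wedge p_n$ lies in $\operatorname{dom}\Delta$ and \[\Delta(p_1\wedge\dots\wedge p_n)=(\Delta_{\mathfrak p}p_1)\wedge\dots\wedge(\Delta_{\mathfrak p}p_n).\] The domain of the restriction of $\Delta$ to the $n$-particle subspace is $\bigwedge^n\operatorname{dom}\Delta_{\mathfrak p}$, understood as the completion in the graph norm of $\Delta$ of the linear span of these vectors; that is, this linear span is a core for the restriction of $\Delta$ to the $n$-particle subspace. (ii) $J$ maps $\mathfrak p$ onto $\mathfrak p$, and for all $n$ and all $p_1,\dots,p_n\in\mathfrak p$ \[J(p_1\wedge\dots\wedge p_n)=(Jp_n)\wedge\dots\wedge(Jp_1).\] -/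

import Mathlib

open scoped ComplexConjugate

noncomputable section FockSpaceConstruction

variable {E : Type*} [NormedAddCommGroup E] [InnerProductSpace ℂ E]

/-- The contraction `x ↦ p ⌋ x` of the exterior algebra by the functional `⟪p, ·⟫`. -/
def algAnnihilation (p : E) : ExteriorAlgebra ℂ E →ₗ[ℂ] ExteriorAlgebra ℂ E :=
  CliffordAlgebra.contractLeft (Q := (0 : QuadraticForm ℂ E)) (innerₛₗ ℂ p)

lemma algAnnihilation_one (p : E) : algAnnihilation p 1 = 0 :=
  CliffordAlgebra.contractLeft_one (Q := (0 : QuadraticForm ℂ E)) _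

lemma algAnnihilation_ι_mul (p q : E) (x : ExteriorAlgebra ℂ E) :
    algAnnihilation p (ExteriorAlgebra.ι ℂ q * x) =
      inner ℂ p q • x - ExteriorAlgebra.ι ℂ q * algAnnihilation p x :=
  CliffordAlgebra.contractLeft_ι_mul _ _ _

lemma algAnnihilation_algAnnihilation (p : E) (x : ExteriorAlgebra ℂ E) :
    algAnnihilation p (algAnnihilation p x) = 0 :=
  CliffordAlgebra.contractLeft_contractLeft _ _

lemma algAnnihilation_add (p q : E) (x : ExteriorAlgebra ℂ E) :
    algAnnihilation (p + q) x = algAnnihilation p x + algAnnihilation q x := by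
  simp [algAnnihilation]

lemma algAnnihilation_smul (c : ℂ) (p : E) (x : ExteriorAlgebra ℂ E) :
    algAnnihilation (c • p) x = conj c • algAnnihilation p x := by
  simp [algAnnihilation]

/-- The linear map sending `p` to the operator `φ ↦ φ ∘ (p ⌋ ·)` on antilinear functionals. -/
def fockFormStep : E →ₗ[ℂ] Module.End ℂ (ExteriorAlgebra ℂ E →ₗ⋆[ℂ] ℂ) where
  toFun p :=
    { toFun := fun φ => φ.comp (algAnnihilation p)
      map_add' := fun _ _ => rfl
      map_smul' := fun _ _ => rfl }
  map_add' p q := by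
    ext φ x
    simp [algAnnihilation_add]
  map_smul' c p := by
    ext φ x
    simp [algAnnihilation_smul]

/-- The antilinear functional taking the complex conjugate of the scalar component. -/
def vacuumFunctional : ExteriorAlgebra ℂ E →ₗ⋆[ℂ] ℂ where
  toFun x := conj (ExteriorAlgebra.algebraMapInv x)
  map_add' := by simp
  map_smul' := by simp

/-- The scalar product on the algebraic Fock space `⨁ₙ ⋀ⁿ E`, antilinear in the first variable:
the unique sesquilinear form with `⟪1, 1⟫ = 1`, `⟪p ∧ x, 1⟫ = 0` and
`⟪x, p ∧ y⟫ = ⟪p ⌋ x, y⟫`.  It satisfies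
`⟪p₁ ∧ … ∧ pₙ, q₁ ∧ … ∧ qₘ⟫ = 0` for `n ≠ m` and `= det (⟪pᵢ, qⱼ⟫)` for `n = m`. -/
def fockForm (x y : ExteriorAlgebra ℂ E) : ℂ :=
  ExteriorAlgebra.lift ℂ ⟨fockFormStep (E := E), fun p => by
    ext φ x
    simp [fockFormStep, algAnnihilation_algAnnihilation]⟩ y vacuumFunctional x

lemma fockForm_add_left (x y z : ExteriorAlgebra ℂ E) :
    fockForm (x + y) z = fockForm x z + fockForm y z := by
  simp [fockForm]

lemma fockForm_smul_left (c : ℂ) (x z : ExteriorAlgebra ℂ E) :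
    fockForm (c • x) z = conj c * fockForm x z := by
  simp [fockForm]

lemma fockForm_add_right (x y z : ExteriorAlgebra ℂ E) :
    fockForm x (y + z) = fockForm x y + fockForm x z := by
  simp [fockForm]

lemma fockForm_smul_right (c : ℂ) (x z : ExteriorAlgebra ℂ E) :
    fockForm x (c • z) = c * fockForm x z := by
  simp [fockForm]

lemma fockForm_ι_mul_right (p : E) (x y : ExteriorAlgebra ℂ E) :
    fockForm x (ExteriorAlgebra.ι ℂ p * y) = fockForm (algAnnihilation p x) y := by
  simp only [fockForm, map_mul, ExteriorAlgebra.lift_ι_apply]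
  rfl

lemma fockForm_one_right (x : ExteriorAlgebra ℂ E) :
    fockForm x 1 = conj (ExteriorAlgebra.algebraMapInv x) := by
  simp only [fockForm, map_one]
  rfl

lemma fockForm_zero_left (x : ExteriorAlgebra ℂ E) : fockForm 0 x = 0 := by
  simp [fockForm]

lemma fockForm_zero_right (x : ExteriorAlgebra ℂ E) : fockForm x 0 = 0 := by
  simp [fockForm]

lemma fockForm_sub_left (x y z : ExteriorAlgebra ℂ E) :
    fockForm (x - y) z = fockForm x z - fockForm y z := by
  simp [fockForm]

lemma fockForm_sub_right (x y z : ExteriorAlgebra ℂ E) :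
    fockForm x (y - z) = fockForm x y - fockForm x z := by
  simp [fockForm]

/-- Induction on the exterior algebra by left multiplication with vectors. -/
lemma exterior_induction_left {C : ExteriorAlgebra ℂ E → Prop} (one : C 1)
    (add : ∀ x y, C x → C y → C (x + y)) (smul : ∀ (c : ℂ) x, C x → C (c • x))
    (ι_mul : ∀ (p : E) x, C x → C (ExteriorAlgebra.ι ℂ p * x)) (x : ExteriorAlgebra ℂ E) :
    C x := by
  have h : ∀ y, C y → C (x * y) := by
    induction x using ExteriorAlgebra.induction with
    | algebraMap r =>
      intro y hy
      rw [← Algebra.smul_def]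
      exact smul r y hy
    | ι p => exact fun y hy => ι_mul p y hy
    | mul a b ha hb =>
      intro y hy
      rw [mul_assoc]
      exact ha _ (hb _ hy)
    | add a b ha hb =>
      intro y hy
      rw [add_mul]
      exact add _ _ (ha _ hy) (hb _ hy)
  simpa using h 1 one

lemma fockForm_ι_mul_left (p : E) (x y : ExteriorAlgebra ℂ E) :
    fockForm (ExteriorAlgebra.ι ℂ p * x) y = fockForm x (algAnnihilation p y) := by
  induction y using exterior_induction_left generalizing x with
  | one =>
    rw [algAnnihilation_one, fockForm_one_right, fockForm_zero_right, map_mul]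
    simp [ExteriorAlgebra.algebraMapInv]
  | add a b ha hb => rw [fockForm_add_right, ha, hb, map_add, fockForm_add_right]
  | smul c a ha => rw [fockForm_smul_right, ha, map_smul, fockForm_smul_right]
  | ι_mul q a ha =>
    rw [fockForm_ι_mul_right, algAnnihilation_ι_mul, algAnnihilation_ι_mul, fockForm_sub_left,
      fockForm_sub_right, fockForm_smul_left, fockForm_smul_right, ha, fockForm_ι_mul_right,
      inner_conj_symm]

lemma fockForm_one_left (y : ExteriorAlgebra ℂ E) :
    fockForm 1 y = ExteriorAlgebra.algebraMapInv y := by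
  induction y using exterior_induction_left with
  | one => simp [fockForm_one_right]
  | add a b ha hb => rw [fockForm_add_right, ha, hb, map_add]
  | smul c a ha => rw [fockForm_smul_right, ha, map_smul, smul_eq_mul]
  | ι_mul q a ha =>
    rw [fockForm_ι_mul_right, algAnnihilation_one, fockForm_zero_left, map_mul]
    simp [ExteriorAlgebra.algebraMapInv]

lemma fockForm_conj_symm (x y : ExteriorAlgebra ℂ E) : conj (fockForm y x) = fockForm x y := by
  induction y using exterior_induction_left generalizing x with
  | one => rw [fockForm_one_left, fockForm_one_right]
  | add a b ha hb => rw [fockForm_add_left, fockForm_add_right, map_add, ha, hb]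
  | smul c a ha => rw [fockForm_smul_left, fockForm_smul_right, map_mul, ha, Complex.conj_conj]
  | ι_mul q a ha => rw [fockForm_ι_mul_left, fockForm_ι_mul_right, ha]

/-- The linear span of the products `e_{i₁} ∧ … ∧ e_{iₖ}` of vectors from a list. -/
def wedgeSpanList : List E → Submodule ℂ (ExteriorAlgebra ℂ E)
  | [] => Submodule.span ℂ {1}
  | e :: l => wedgeSpanList l ⊔ (wedgeSpanList l).map (LinearMap.mulLeft ℂ (ExteriorAlgebra.ι ℂ e))

lemma mem_wedgeSpanList_cons {e : E} {l : List E} {x : ExteriorAlgebra ℂ E} :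
    x ∈ wedgeSpanList (e :: l) ↔ ∃ a ∈ wedgeSpanList l, ∃ b ∈ wedgeSpanList l,
      a + ExteriorAlgebra.ι ℂ e * b = x := by
  simp [wedgeSpanList, Submodule.mem_sup]

lemma one_mem_wedgeSpanList (l : List E) : (1 : ExteriorAlgebra ℂ E) ∈ wedgeSpanList l := by
  induction l with
  | nil => exact Submodule.mem_span_singleton_self 1
  | cons e l ih => exact Submodule.mem_sup_left ih

lemma ι_mul_mem_wedgeSpanList {l : List E} {v : E} (hv : v ∈ l) {x : ExteriorAlgebra ℂ E}
    (hx : x ∈ wedgeSpanList l) : ExteriorAlgebra.ι ℂ v * x ∈ wedgeSpanList l := by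
  induction l generalizing x with
  | nil => simp at hv
  | cons e l ih =>
    obtain ⟨a, ha, b, hb, rfl⟩ := mem_wedgeSpanList_cons.1 hx
    rw [mem_wedgeSpanList_cons]
    rcases List.mem_cons.1 hv with rfl | hv
    · refine ⟨0, zero_mem _, a, ha, ?_⟩
      rw [mul_add, ← mul_assoc, ExteriorAlgebra.ι_sq_zero]
      simp
    · refine ⟨_, ih hv ha, -(ExteriorAlgebra.ι ℂ v * b), neg_mem (ih hv hb), ?_⟩
      have h := ExteriorAlgebra.ι_add_mul_swap (R := ℂ) v e
      rw [mul_add, mul_neg, ← mul_assoc, ← mul_assoc, eq_neg_of_add_eq_zero_left h, neg_mul]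

lemma span_mul_mem_wedgeSpanList {l : List E} {v : E} (hv : v ∈ Submodule.span ℂ {u | u ∈ l})
    {x : ExteriorAlgebra ℂ E} (hx : x ∈ wedgeSpanList l) :
    ExteriorAlgebra.ι ℂ v * x ∈ wedgeSpanList l := by
  induction hv using Submodule.span_induction with
  | mem u hu => exact ι_mul_mem_wedgeSpanList hu hx
  | zero => simp
  | add u w _ _ hu hw => rw [map_add, add_mul]; exact add_mem hu hw
  | smul c u _ hu => rw [map_smul, smul_mul_assoc]; exact Submodule.smul_mem _ c hu

lemma algAnnihilation_wedgeSpanList {l : List E} {e : E} (he : ∀ v ∈ l, inner ℂ e v = 0)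
    {x : ExteriorAlgebra ℂ E} (hx : x ∈ wedgeSpanList l) : algAnnihilation e x = 0 := by
  induction l generalizing x with
  | nil =>
    obtain ⟨c, rfl⟩ := Submodule.mem_span_singleton.1 hx
    rw [map_smul, algAnnihilation_one, smul_zero]
  | cons f l ih =>
    obtain ⟨a, ha, b, hb, rfl⟩ := mem_wedgeSpanList_cons.1 hx
    have h' : ∀ v ∈ l, inner ℂ e v = 0 := fun v hv => he v (List.mem_cons_of_mem _ hv)
    rw [map_add, ih h' ha, algAnnihilation_ι_mul, ih h' hb, he f List.mem_cons_self]
    simp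

lemma fockForm_pos_wedgeSpanList {l : List E} (hn : ∀ v ∈ l, inner ℂ v v = (1 : ℂ))
    (ho : l.Pairwise fun v w => inner ℂ v w = (0 : ℂ)) {x : ExteriorAlgebra ℂ E}
    (hx : x ∈ wedgeSpanList l) : 0 ≤ (fockForm x x).re ∧ (fockForm x x = 0 → x = 0) := by
  induction l generalizing x with
  | nil =>
    obtain ⟨c, rfl⟩ := Submodule.mem_span_singleton.1 hx
    rw [fockForm_smul_left, fockForm_smul_right, fockForm_one_right, map_one, map_one, mul_one,
      Complex.conj_mul']
    refine ⟨by rw [← Complex.ofReal_pow, Complex.ofReal_re]; positivity, fun h => ?_⟩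
    simp_all
  | cons e l ih =>
    obtain ⟨a, ha, b, hb, rfl⟩ := mem_wedgeSpanList_cons.1 hx
    obtain ⟨ho1, ho2⟩ := List.pairwise_cons.1 ho
    have hn' : ∀ v ∈ l, inner ℂ v v = (1 : ℂ) := fun v hv => hn v (List.mem_cons_of_mem _ hv)
    have key : fockForm (a + ExteriorAlgebra.ι ℂ e * b) (a + ExteriorAlgebra.ι ℂ e * b) =
        fockForm a a + fockForm b b := by
      simp only [fockForm_add_left, fockForm_add_right, fockForm_ι_mul_left, fockForm_ι_mul_right,
        map_add, algAnnihilation_ι_mul, algAnnihilation_wedgeSpanList ho1 ha,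
        algAnnihilation_wedgeSpanList ho1 hb, hn e List.mem_cons_self, fockForm_zero_left,
        fockForm_zero_right]
      simp
    obtain ⟨ha1, ha2⟩ := ih hn' ho2 ha
    obtain ⟨hb1, hb2⟩ := ih hn' ho2 hb
    rw [key, Complex.add_re]
    refine ⟨add_nonneg ha1 hb1, fun h => ?_⟩
    have him : ∀ z : ExteriorAlgebra ℂ E, (fockForm z z).im = 0 := fun z =>
      Complex.conj_eq_iff_im.1 (fockForm_conj_symm z z)
    have hre : (fockForm a a).re + (fockForm b b).re = 0 := by
      rw [← Complex.add_re, h, Complex.zero_re]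
    rw [ha2 (Complex.ext (by simp; linarith) (him a)), hb2 (Complex.ext (by simp; linarith) (him b))]
    simp

lemma exists_orthonormal_wedgeSpanList (x : ExteriorAlgebra ℂ E) :
    ∃ l : List E, (∀ v ∈ l, inner ℂ v v = (1 : ℂ)) ∧
      (l.Pairwise fun v w => inner ℂ v w = (0 : ℂ)) ∧ x ∈ wedgeSpanList l := by
  have h : ∃ V : Submodule ℂ E, FiniteDimensional ℂ V ∧
      ∀ l : List E, V ≤ Submodule.span ℂ {u | u ∈ l} → x ∈ wedgeSpanList l := by
    induction x using exterior_induction_left with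
    | one => exact ⟨⊥, inferInstance, fun l _ => one_mem_wedgeSpanList l⟩
    | add a b ha hb =>
      obtain ⟨V, _, hV⟩ := ha
      obtain ⟨W, _, hW⟩ := hb
      exact ⟨V ⊔ W, inferInstance, fun l hl =>
        add_mem (hV l (le_sup_left.trans hl)) (hW l (le_sup_right.trans hl))⟩
    | smul c a ha =>
      obtain ⟨V, hV', hV⟩ := ha
      exact ⟨V, hV', fun l hl => Submodule.smul_mem _ c (hV l hl)⟩
    | ι_mul p a ha =>
      obtain ⟨V, _, hV⟩ := ha
      exact ⟨V ⊔ Submodule.span ℂ {p}, inferInstance, fun l hl => span_mul_mem_wedgeSpanList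
        (hl (le_sup_right (a := V) (Submodule.mem_span_singleton_self p)))
        (hV l (le_sup_left.trans hl))⟩
  obtain ⟨V, _, hV⟩ := h
  set b := stdOrthonormalBasis ℂ V with hb
  have hbo : Orthonormal ℂ fun i => (b i : E) :=
    b.orthonormal.comp_linearIsometry V.subtypeₗᵢ
  refine ⟨List.ofFn fun i => (b i : E), ?_, ?_, hV _ ?_⟩
  · intro v hv
    obtain ⟨i, rfl⟩ := (List.mem_ofFn' _ _).1 hv
    rw [inner_self_eq_norm_sq_to_K, hbo.1 i]
    simp
  · rw [List.pairwise_ofFn]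
    exact fun i j hij => hbo.2 hij.ne
  · intro v hv
    have h1 : (⟨v, hv⟩ : V) ∈ Submodule.span ℂ (Set.range b) := by
      rw [← b.coe_toBasis, b.toBasis.span_eq]
      trivial
    have h2 := Submodule.mem_map_of_mem (f := V.subtype) h1
    rw [Submodule.map_span, ← Set.range_comp] at h2
    refine Submodule.span_mono ?_ h2
    rintro _ ⟨i, rfl⟩
    exact (List.mem_ofFn' _ _).2 ⟨i, rfl⟩

/-- The scalar product of the algebraic Fock space. -/
abbrev fockCore : InnerProductSpace.Core ℂ (ExteriorAlgebra ℂ E) where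
  inner := fockForm
  conj_inner_symm x y := fockForm_conj_symm x y
  re_inner_nonneg x := by
    obtain ⟨l, hn, ho, hx⟩ := exists_orthonormal_wedgeSpanList x
    exact (fockForm_pos_wedgeSpanList hn ho hx).1
  add_left := fockForm_add_left
  smul_left x y c := fockForm_smul_left c x y
  definite x h := by
    obtain ⟨l, hn, ho, hx⟩ := exists_orthonormal_wedgeSpanList x
    exact (fockForm_pos_wedgeSpanList hn ho hx).2 h

instance instNormedAddCommGroupExterior : NormedAddCommGroup (ExteriorAlgebra ℂ E) :=
  (fockCore (E := E)).toNormedAddCommGroup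

instance instInnerProductSpaceExterior : InnerProductSpace ℂ (ExteriorAlgebra ℂ E) :=
  InnerProductSpace.ofCore (fockCore (E := E)).toCore

lemma inner_exterior_eq (x y : ExteriorAlgebra ℂ E) : inner ℂ x y = fockForm x y := rfl

lemma norm_ι_mul_sq_add (p : E) (x : ExteriorAlgebra ℂ E) :
    ‖ExteriorAlgebra.ι ℂ p * x‖ ^ 2 + ‖algAnnihilation p x‖ ^ 2 = (‖p‖ * ‖x‖) ^ 2 := by
  have h : (inner ℂ (ExteriorAlgebra.ι ℂ p * x) (ExteriorAlgebra.ι ℂ p * x) +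
      inner ℂ (algAnnihilation p x) (algAnnihilation p x) : ℂ) = inner ℂ p p * inner ℂ x x := by
    simp only [inner_exterior_eq, fockForm_ι_mul_left, ← fockForm_ι_mul_right,
      algAnnihilation_ι_mul, fockForm_sub_right, fockForm_smul_right]
    ring
  simp only [inner_self_eq_norm_sq_to_K] at h
  rw [mul_pow]
  exact_mod_cast h

/-- The antisymmetric Fock space over `E`: the Hilbert space completion of `⨁ₙ ⋀ⁿ E`. -/
abbrev FockSpace (E : Type*) [NormedAddCommGroup E] [InnerProductSpace ℂ E] : Type _ :=
  UniformSpace.Completion (ExteriorAlgebra ℂ E)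

/-- The creation operator `c(p)^*`: `c(p)^* (p₁ ∧ … ∧ pₙ) = p ∧ p₁ ∧ … ∧ pₙ`. -/
def creation (p : E) : FockSpace E →L[ℂ] FockSpace E :=
  ((LinearMap.mulLeft ℂ (ExteriorAlgebra.ι ℂ p)).mkContinuous ‖p‖ fun x => by
    refine abs_le_of_sq_le_sq' ?_ (by positivity) |>.2
    rw [← norm_ι_mul_sq_add]
    exact le_add_of_nonneg_right (sq_nonneg _)).completion

/-- The annihilation operator `c(p)`:
`c(p) (p₁ ∧ … ∧ pₙ) = ∑ᵣ (-1)^(r-1) ⟪p, pᵣ⟫ p₁ ∧ … ∧ p̂ᵣ ∧ … ∧ pₙ`. -/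
def annihilation (p : E) : FockSpace E →L[ℂ] FockSpace E :=
  ((algAnnihilation p).mkContinuous ‖p‖ fun x => by
    refine abs_le_of_sq_le_sq' ?_ (by positivity) |>.2
    rw [← norm_ι_mul_sq_add]
    exact le_add_of_nonneg_left (sq_nonneg _)).completion

end FockSpaceConstruction

noncomputable section FockSpaceVectors

variable {E : Type*} [NormedAddCommGroup E] [InnerProductSpace ℂ E]

/-- The vector `p₁ ∧ … ∧ pₙ` of Fock space; for `n = 0` it is the vacuum. -/
def wedge (n : ℕ) (p : Fin n → E) : FockSpace E :=
  ((ExteriorAlgebra.ιMulti ℂ n p : ExteriorAlgebra ℂ E) : FockSpace E)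

/-- The Fock vacuum `Ω`. -/
def vacuum (E : Type*) [NormedAddCommGroup E] [InnerProductSpace ℂ E] : FockSpace E :=
  ((1 : ExteriorAlgebra ℂ E) : FockSpace E)

/-- The embedding of the one-particle space into Fock space. -/
def oneParticle (p : E) : FockSpace E :=
  ((ExteriorAlgebra.ι ℂ p : ExteriorAlgebra ℂ E) : FockSpace E)

/-- The (closed) `n`-particle subspace of Fock space. -/
def nParticle (E : Type*) [NormedAddCommGroup E] [InnerProductSpace ℂ E] (n : ℕ) :
    Submodule ℂ (FockSpace E) :=
  (Submodule.span ℂ (Set.range (wedge (E := E) n))).topologicalClosure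

instance (n : ℕ) : (nParticle E n).HasOrthogonalProjection := by
  unfold nParticle
  infer_instance

/-- The algebraic `n`-th exterior power of a linear subspace `D` of the one-particle space: finite
linear combinations of vectors `p₁ ∧ … ∧ pₙ` with all `pᵢ ∈ D`. -/
def algWedgePower (n : ℕ) (D : Submodule ℂ E) : Submodule ℂ (FockSpace E) :=
  Submodule.span ℂ {ψ | ∃ p : Fin n → E, (∀ i, p i ∈ D) ∧ ψ = wedge n p}

end FockSpaceVectors

noncomputable section ModularTheory

variable {H : Type*} [NormedAddCommGroup H] [InnerProductSpace ℂ H]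

/-- The graph of the adjoint `R*` of the antilinear operator with graph `R`, characterised by
`⟪R x, y⟫ = ⟪R* y, x⟫` for all `x` in the domain of `R`. -/
def antilinearAdjoint (R : SetRel H H) : SetRel H H :=
  {z | ∀ w ∈ R, inner ℂ w.2 z.1 = (inner ℂ z.2 w.1 : ℂ)}

/-- `Ω` is cyclic for the set `M` of bounded operators. -/
def IsCyclicVector (M : Set (H →L[ℂ] H)) (Ω : H) : Prop := Dense {ψ | ∃ A ∈ M, ψ = A Ω}

/-- `Ω` is separating for the set `M` of bounded operators. -/
def IsSeparatingVector (M : Set (H →L[ℂ] H)) (Ω : H) : Prop := ∀ A ∈ M, A Ω = 0 → A = 0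

variable [CompleteSpace H]

/-- The graph of the Tomita operator `S` of `(M, Ω)`: the closure of the graph of the antilinear
operator `A Ω ↦ A* Ω`, `A ∈ M`. -/
def tomitaGraph (M : Set (H →L[ℂ] H)) (Ω : H) : SetRel H H :=
  closure {z | ∃ A ∈ M, z = (A Ω, ContinuousLinearMap.adjoint A Ω)}

/-- `T` is a (possibly unbounded) positive self-adjoint operator. -/
structure IsPositiveSelfAdjoint (T : H →ₗ.[ℂ] H) : Prop where
  dense : Dense (T.domain : Set H)
  selfAdjoint : IsSelfAdjoint T
  nonneg : ∀ x : T.domain, 0 ≤ (inner ℂ (x : H) (T x) : ℂ).re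

/-- `S = J T` is a polar decomposition of the injective antilinear operator with graph `S` and
dense range: `J` is antiunitary, `T` is positive self-adjoint and has the same domain as `S`. -/
structure IsPolarDecomposition (S : SetRel H H) (J : H ≃ₗᵢ⋆[ℂ] H) (T : H →ₗ.[ℂ] H) : Prop where
  positive : IsPositiveSelfAdjoint T
  graph_eq : S = Set.range fun x : T.domain => ((x : H), J (T x))

end ModularTheory

noncomputable section SelfDualCAR

variable {𝓱 : Type*} [NormedAddCommGroup 𝓱] [InnerProductSpace ℂ 𝓱]

/-- The orthogonal projection `P` onto `𝔭` is a basis projection: `P + Γ P Γ = 1`. -/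
def IsBasisProjection (Γ : 𝓱 ≃ₗᵢ⋆[ℂ] 𝓱) (𝔭 : Submodule ℂ 𝓱) [𝔭.HasOrthogonalProjection] : Prop :=
  ∀ f, 𝔭.starProjection f + Γ (𝔭.starProjection (Γ f)) = f

/-- The subspaces `𝔭` and `𝔮` are in generic position. -/
structure InGenericPosition (𝔭 𝔮 : Submodule ℂ 𝓱) : Prop where
  inf_eq_bot : 𝔭 ⊓ 𝔮 = ⊥
  inf_orthogonal_eq_bot : 𝔭 ⊓ 𝔮ᗮ = ⊥
  orthogonal_inf_eq_bot : 𝔭ᗮ ⊓ 𝔮 = ⊥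
  orthogonal_inf_orthogonal_eq_bot : 𝔭ᗮ ⊓ 𝔮ᗮ = ⊥

variable (Γ : 𝓱 ≃ₗᵢ⋆[ℂ] 𝓱) (𝔭 𝔮 : Submodule ℂ 𝓱) [𝔭.HasOrthogonalProjection]

/-- The generators of the self-dual CAR-algebra in the Fock representation given by the
projection `P` onto `𝔭`: `a(f) = c(P Γ f)^* + c(P f)`. -/
def fieldOperator (f : 𝓱) : FockSpace 𝔭 →L[ℂ] FockSpace 𝔭 :=
  creation (𝔭.orthogonalProjectionOnto (Γ f)) + annihilation (𝔭.orthogonalProjectionOnto f)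

/-- The von Neumann algebra `M(𝔮) = {a(q) | q ∈ 𝔮}''` on Fock space. -/
def carVonNeumannAlgebra : Set (FockSpace 𝔭 →L[ℂ] FockSpace 𝔭) :=
  Set.centralizer (Set.centralizer (fieldOperator Γ 𝔭 '' (𝔮 : Set 𝓱)))

/-- The graph `{(P q, P Γ q) | q ∈ 𝔮}` of the antilinear operator `β` on `𝔭`. -/
def betaGraph : SetRel 𝔭 𝔭 :=
  {z | ∃ q ∈ 𝔮, z = (𝔭.orthogonalProjectionOnto q, 𝔭.orthogonalProjectionOnto (Γ q))}

end SelfDualCAR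

/-!
The proof replaces the unbounded operators in question by pairs of commuting bounded ones.

**One particle.**  On `𝔭` let `x = (P Q P)^{1/2}` and `y = (1 - x²)^{1/2}`.  Generic position makes
both injective.  The antilinear map `x y u ↦ P Γ Q u` is isometric with dense domain and range, and
extends to an antiunitary operator `j`.  Then `β = j x⁻¹ y`, in the sense that `(a, b)` lies in the
graph of `β` if and only if `y a = x (j⁻¹ b)`; this is `exists_isPolarData`.  Quotients `X⁻¹ Y` of
this kind, with graph `{(c, d) | Y c = X d}`, are easy to handle: the vectors `(X u, Y u)` are dense
in the graph (`IsCommutingPair.mem_closure_range`), which gives self-adjointness, positivity, and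
`(X⁻¹ Y)² = X⁻² Y²` with the correct domains (`IsCommutingPair.graph_sq`).

**Second quantization.**  The symmetric contractions `x`, `y` induce commuting injective
contractions `X = Γ(x)`, `Y = Γ(y)` on Fock space (`secondQuant`), and `j`, combined with the
reversal of the factors, induces an antiunitary operator `J` (`exists_antiunitary_wedge`).  The
claim is that the Tomita operator equals `J X⁻¹ Y` (`IsPolarData.mem_tomitaGraph_iff`).

**Wick products.**  Besides the generators `c(s)^* + c(t)`, `(s, t) ∈ β`, there are the twisted field
operators acting from the right, for pairs in the graph of `β*`, which commute with them.  The
normally ordered product of generators is an element `A` of the algebra with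
`A Ω = s₁ ∧ … ∧ sₙ` and `A* Ω = tₙ ∧ … ∧ t₁`, as soon as the `tᵢ` lie in the domain of `β*`; products
of twisted fields give such elements of the commutant (`exists_wick`).  With
`sᵢ = x² pᵢ`, `tᵢ = j y x pᵢ` the vectors `A Ω` form a core of `J X⁻¹ Y`, so the Tomita operator
extends `J X⁻¹ Y`.  Conversely, the identity `⟪A* Ω, A' Ω⟫ = ⟪A'* Ω, A Ω⟫` for `A` in the algebra and
a Wick product `A'` in the commutant says that `Y A Ω = X J⁻¹ A* Ω`.  Neither density theorems nor
Tomita-Takesaki theory are needed.  Cyclicity and separation follow from the same products.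

**Conclusion.**  The polar decomposition is unique because a positive self-adjoint operator is
determined by its square (`IsPositiveSelfAdjoint.eq_of_sq_eq`).  Hence the modular operator is
`X⁻² Y²`, which is the quotient of the second quantizations of `y²` and `x²`, and all assertions on
particle numbers, wedge products and cores can be read off.  The domain `P Q 𝔭` of
`β* β = x⁻² y²` is the range of `x²`, because `x² + y² = 1`.
-/

/-! ### Antiunitary operators -/

section Antiunitary

variable {H : Type*} [NormedAddCommGroup H] [InnerProductSpace ℂ H]

lemma antiunitary_inner_map_map (J : H ≃ₗᵢ⋆[ℂ] H) (x y : H) :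
    inner ℂ (J x) (J y) = (inner ℂ y x : ℂ) := by
  rw [← inner_conj_symm y x, inner_eq_sum_norm_sq_div_four x y,
    inner_eq_sum_norm_sq_div_four (J x) (J y)]
  have h1 : ‖J x + J y‖ = ‖x + y‖ := by rw [← map_add, J.norm_map]
  have h2 : ‖J x - J y‖ = ‖x - y‖ := by rw [← map_sub, J.norm_map]
  have h3 : ‖J x - Complex.I • J y‖ = ‖x + Complex.I • y‖ := by
    rw [← J.norm_map (x + _), map_add, map_smulₛₗ]
    simp [sub_eq_add_neg]
  have h4 : ‖J x + Complex.I • J y‖ = ‖x - Complex.I • y‖ := by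
    rw [← J.norm_map (x - _), map_sub, map_smulₛₗ]
    simp
  simp only [RCLike.I_to_complex, RCLike.ofReal_eq_complex_ofReal] at *
  rw [h1, h2, h3, h4]
  simp only [map_div₀, map_add, map_mul, map_sub, map_pow, Complex.conj_ofReal, Complex.conj_I]
  rw [show (starRingEnd ℂ) 4 = 4 from Complex.conj_ofNat 4]
  ring

lemma antiunitary_inner_symm_left (J : H ≃ₗᵢ⋆[ℂ] H) (x y : H) :
    inner ℂ (J.symm x) y = (inner ℂ (J y) x : ℂ) := by
  rw [← antiunitary_inner_map_map J, J.apply_symm_apply]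

/-- An antilinear map that is isometric relative to a linear one extends to an antiunitary
operator as soon as both have dense range. -/
theorem exists_antiunitary_extension [CompleteSpace H] {M : Type*} [AddCommGroup M] [Module ℂ M]
    (A : M →ₗ[ℂ] H) (C : M →ₗ⋆[ℂ] H) (hA : DenseRange A) (hC : DenseRange C)
    (h : ∀ u, ‖C u‖ = ‖A u‖) : ∃ J : H ≃ₗᵢ⋆[ℂ] H, ∀ u, J (A u) = C u := by
  have hb : ∃ k : ℝ, ∀ u, ‖C u‖ ≤ k * ‖A u‖ := ⟨1, fun u => by rw [h, one_mul]⟩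
  have hext : ∀ u, C.extendOfNorm A (A u) = C u := C.extendOfNorm_eq hA hb
  have hnorm : ∀ x, ‖C.extendOfNorm A x‖ = ‖x‖ := by
    intro x
    refine hA.induction_on x (isClosed_eq (by fun_prop) (by fun_prop)) fun u => ?_
    rw [hext, h]
  let L : H →ₛₗᵢ[starRingEnd ℂ] H := ⟨(C.extendOfNorm A).toLinearMap, hnorm⟩
  have hL : Function.Surjective L := by
    have hcl : IsClosed (Set.range L) := L.isometry.isClosedEmbedding.isClosed_range
    have hsub : Set.range C ⊆ Set.range L := by
      rintro _ ⟨u, rfl⟩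
      exact ⟨A u, hext u⟩
    rw [← Set.range_eq_univ, ← hcl.closure_eq]
    exact (hC.mono hsub).closure_eq
  exact ⟨LinearIsometryEquiv.ofSurjective L hL, hext⟩

end Antiunitary

/-! ### Self-adjoint operators given by commuting bounded operators -/

noncomputable section CommutingPairs

variable {H : Type*} [NormedAddCommGroup H] [InnerProductSpace ℂ H]

lemma denseRange_of_symmetric_of_injective [CompleteSpace H] {X : H →L[ℂ] H}
    (hX : ∀ u v, inner ℂ (X u) v = (inner ℂ u (X v) : ℂ)) (hinj : ∀ u, X u = 0 → u = 0) :
    DenseRange X := by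
  have h : (LinearMap.range X.toLinearMap).topologicalClosure = ⊤ := by
    rw [Submodule.topologicalClosure_eq_top_iff, Submodule.eq_bot_iff]
    intro v hv
    refine hinj v (ext_inner_left ℂ fun u => ?_)
    rw [← hX, inner_zero_right]
    exact hv _ ⟨u, rfl⟩
  intro v
  have : v ∈ (LinearMap.range X.toLinearMap).topologicalClosure := h ▸ Submodule.mem_top
  exact this

/-- In a product of Hilbert spaces, a subspace is dense in a closed subspace containing it if its
orthogonal complement there is trivial. -/
lemma le_topologicalClosure_of_orthogonal [CompleteSpace H] {K G : Submodule ℂ (H × H)} (hKG : K ≤ G)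
    (hG : IsClosed (G : Set (H × H)))
    (h : ∀ z ∈ G, (∀ w ∈ K, (inner ℂ w.1 z.1 + inner ℂ w.2 z.2 : ℂ) = 0) → z = 0) :
    G ≤ K.topologicalClosure := by
  let e := WithLp.prodContinuousLinearEquiv 2 ℂ H H
  let K' : Submodule ℂ (WithLp 2 (H × H)) := K.topologicalClosure.comap e.toLinearMap
  have hK'c : IsClosed (K' : Set (WithLp 2 (H × H))) :=
    K.isClosed_topologicalClosure.preimage e.continuous
  have : CompleteSpace K' := hK'c.completeSpace_coe
  intro z hz
  obtain ⟨p, hp, r, hr, hpr⟩ := K'.exists_add_mem_mem_orthogonal (e.symm z)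
  have hpK : e p ∈ K.topologicalClosure := hp
  have hz' : z = e p + e r := by rw [← map_add, ← hpr, e.apply_symm_apply]
  have hrG : e r ∈ G := by
    have : e r = z - e p := by rw [hz']; abel
    rw [this]
    exact sub_mem hz (K.topologicalClosure_minimal hKG hG hpK)
  have hr0 : e r = 0 := by
    refine h _ hrG fun w hw => ?_
    have hw' : e.symm w ∈ K' := by
      change e (e.symm w) ∈ K.topologicalClosure
      rw [e.apply_symm_apply]
      exact K.le_topologicalClosure hw
    have := hr _ hw'
    rwa [WithLp.prod_inner_apply] at this
  rw [hz', hr0, add_zero]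
  exact hpK

/-- Commuting bounded symmetric operators `X`, `Y` with `X` injective. -/
structure IsCommutingPair (X Y : H →L[ℂ] H) : Prop where
  symm_left : ∀ u v, inner ℂ (X u) v = (inner ℂ u (X v) : ℂ)
  symm_right : ∀ u v, inner ℂ (Y u) v = (inner ℂ u (Y v) : ℂ)
  comm : ∀ u, X (Y u) = Y (X u)
  injective : ∀ u, X u = 0 → u = 0

/-- The relation `{(c, d) | Y c = X d}`: the graph of the quotient `X⁻¹ Y`. -/
def pairGraph (X Y : H →L[ℂ] H) : Submodule ℂ (H × H) :=
  LinearMap.ker ((Y ∘L ContinuousLinearMap.fst ℂ H H) - (X ∘L ContinuousLinearMap.snd ℂ H H) :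
    H × H →L[ℂ] H).toLinearMap

@[simp] lemma mem_pairGraph {X Y : H →L[ℂ] H} {z : H × H} :
    z ∈ pairGraph X Y ↔ Y z.1 = X z.2 := by
  simp [pairGraph, sub_eq_zero]

lemma isClosed_pairGraph (X Y : H →L[ℂ] H) : IsClosed (pairGraph X Y : Set (H × H)) := by
  have : (pairGraph X Y : Set (H × H)) = {z | Y z.1 = X z.2} := by
    ext z
    simp
  rw [this]
  exact isClosed_eq (by fun_prop) (by fun_prop)

/-- The operator with graph `{(c, d) | Y c = X d}`. -/
def pairOperator (X Y : H →L[ℂ] H) : H →ₗ.[ℂ] H := (pairGraph X Y).toLinearPMap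

namespace IsCommutingPair

variable {X Y : H →L[ℂ] H}

lemma graph_pairOperator (h : IsCommutingPair X Y) : (pairOperator X Y).graph = pairGraph X Y := by
  refine Submodule.toLinearPMap_graph_eq _ fun z hz hz1 => h.injective _ ?_
  rw [mem_pairGraph, hz1, map_zero] at hz
  exact hz.symm

lemma mem_graph (h : IsCommutingPair X Y) {c d : H} :
    (c, d) ∈ (pairOperator X Y).graph ↔ Y c = X d := by
  rw [h.graph_pairOperator, mem_pairGraph]

lemma sq (h : IsCommutingPair X Y) : IsCommutingPair (X * X) (Y * Y) where
  symm_left u v := by simp [h.symm_left]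
  symm_right u v := by simp [h.symm_right]
  comm u := by simp [h.comm]
  injective u hu := h.injective _ (h.injective _ (by simpa using hu))

variable [CompleteSpace H]

lemma denseRange (h : IsCommutingPair X Y) : DenseRange X :=
  denseRange_of_symmetric_of_injective h.symm_left h.injective

/-- The vectors `(X u, Y u)` are dense in the graph: if `Y c = X d` and `X c + Y d = 0`, then
`(X² + Y²) c = 0` and `(X² + Y²) d = 0`. -/
lemma mem_closure_range (h : IsCommutingPair X Y) {c d : H} (hcd : Y c = X d) :
    (c, d) ∈ closure (Set.range fun u => (X u, Y u)) := by
  have hle : LinearMap.range (X.prod Y).toLinearMap ≤ pairGraph X Y := by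
    rintro _ ⟨u, rfl⟩
    simp [h.comm]
  have hmain : pairGraph X Y ≤ (LinearMap.range (X.prod Y).toLinearMap).topologicalClosure := by
    refine le_topologicalClosure_of_orthogonal hle (isClosed_pairGraph X Y) ?_
    rintro ⟨a, b⟩ hab hz
    have hab' : Y a = X b := by simpa using hab
    have h0 : X a + Y b = 0 := by
      refine ext_inner_left ℂ fun u => ?_
      have := hz (X u, Y u) ⟨u, rfl⟩
      simp only [h.symm_left, h.symm_right] at this
      rw [inner_add_right, this, inner_zero_right]
    have key : ∀ v : H, X (X v) + Y (Y v) = 0 → v = 0 := by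
      intro v hv
      have h1 : (inner ℂ (X v) (X v) + inner ℂ (Y v) (Y v) : ℂ) = 0 := by
        rw [h.symm_left, h.symm_right, ← inner_add_right, hv, inner_zero_right]
      rw [inner_self_eq_norm_sq_to_K, inner_self_eq_norm_sq_to_K, ← RCLike.ofReal_pow,
        ← RCLike.ofReal_pow, ← RCLike.ofReal_add, RCLike.ofReal_eq_zero] at h1
      have h3 : ‖X v‖ = 0 := by nlinarith [sq_nonneg ‖X v‖, sq_nonneg ‖Y v‖]
      exact h.injective v (norm_eq_zero.1 h3)
    have ha : a = 0 := key a (by rw [hab', ← h.comm, ← map_add, h0, map_zero])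
    have hb : b = 0 := key b (by rw [← hab', h.comm, ← map_add, h0, map_zero])
    rw [ha, hb]
    rfl
  have hz : ((c, d) : H × H) ∈ pairGraph X Y := by simpa using hcd
  have := hmain hz
  rw [← SetLike.mem_coe, Submodule.topologicalClosure_coe] at this
  convert this using 2
  ext z
  simp [eq_comm]

/-- A refinement of `mem_closure_range`: it suffices to take `u` from a dense set. -/
lemma mem_closure_image (h : IsCommutingPair X Y) {c d : H} (hcd : Y c = X d) {D : Set H}
    (hD : Dense D) : (c, d) ∈ closure ((fun u => (X u, Y u)) '' D) := by
  have hc : Continuous fun u => (X u, Y u) := by fun_prop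
  refine closure_minimal ?_ isClosed_closure (h.mem_closure_range hcd)
  rintro _ ⟨u, rfl⟩
  exact image_closure_subset_closure_image hc ⟨u, hD u, rfl⟩

lemma inner_eq (h : IsCommutingPair X Y) {c d c' d' : H} (hcd : Y c = X d) (hcd' : Y c' = X d') :
    inner ℂ d c' = (inner ℂ c d' : ℂ) := by
  have hsub : closure (Set.range fun u => (X u, Y u)) ⊆
      {z : H × H | (inner ℂ z.2 c' : ℂ) = inner ℂ z.1 d'} := by
    refine closure_minimal ?_ (isClosed_eq (by fun_prop) (by fun_prop))
    rintro _ ⟨u, rfl⟩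
    change (inner ℂ (Y u) c' : ℂ) = inner ℂ (X u) d'
    rw [h.symm_left, h.symm_right, hcd']
  exact hsub (h.mem_closure_range hcd)

lemma dense_domain (h : IsCommutingPair X Y) : Dense ((pairOperator X Y).domain : Set H) := by
  refine h.denseRange.mono ?_
  rintro _ ⟨u, rfl⟩
  rw [SetLike.mem_coe, LinearPMap.mem_domain_iff]
  exact ⟨Y u, h.mem_graph.2 (h.comm u).symm⟩

/-- `X⁻¹ Y` is positive and self-adjoint if `X Y` is nonnegative. -/
lemma isPositiveSelfAdjoint (h : IsCommutingPair X Y)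
    (hpos : ∀ u, 0 ≤ (inner ℂ (X u) (Y u) : ℂ).re) : IsPositiveSelfAdjoint (pairOperator X Y) where
  dense := h.dense_domain
  selfAdjoint := by
    rw [LinearPMap.isSelfAdjoint_def]
    refine LinearPMap.eq_of_eq_graph ?_
    rw [LinearPMap.adjoint_graph_eq_graph_adjoint h.dense_domain]
    ext ⟨c, d⟩
    rw [Submodule.mem_adjoint_iff, h.mem_graph]
    constructor
    · intro hz
      refine ext_inner_left ℂ fun u => ?_
      have := hz (X u) (Y u) (h.mem_graph.2 (h.comm u).symm)
      rwa [sub_eq_zero, h.symm_left, h.symm_right] at this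
    · intro hcd a b hab
      rw [h.inner_eq (h.mem_graph.1 hab) hcd, sub_self]
  nonneg x := by
    have hx : Y x = X (pairOperator X Y x) := h.mem_graph.1 ((pairOperator X Y).mem_graph x)
    have hsub : closure (Set.range fun u => (X u, Y u)) ⊆
        {z : H × H | 0 ≤ (inner ℂ z.1 z.2 : ℂ).re} := by
      refine closure_minimal ?_ (isClosed_le (by fun_prop) (by fun_prop))
      rintro _ ⟨u, rfl⟩
      exact hpos u
    exact hsub (h.mem_closure_range hx)

/-- `(X⁻¹ Y)² = X⁻² Y²` including domains.  If `(X² uₖ, Y² uₖ)` converges, then so does `X Y uₖ`,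
because `‖X Y u‖² ≤ ‖X² u‖ ‖Y² u‖`. -/
lemma exists_mid (h : IsCommutingPair X Y) {c d : H} :
    Y (Y c) = X (X d) ↔ ∃ e, Y c = X e ∧ Y e = X d := by
  constructor
  · intro hcd
    obtain ⟨s, hs, hlim⟩ := mem_closure_iff_seq_limit.1
      (h.sq.mem_closure_range (c := c) (d := d) (by simpa using hcd))
    choose u hu using hs
    obtain rfl : s = fun k => (X (X (u k)), Y (Y (u k))) := funext fun k => (hu k).symm
    have h1 : Filter.Tendsto (fun k => X (X (u k))) Filter.atTop (nhds c) :=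
      (continuous_fst.tendsto _).comp hlim
    have h2 : Filter.Tendsto (fun k => Y (Y (u k))) Filter.atTop (nhds d) :=
      (continuous_snd.tendsto _).comp hlim
    have hbound : ∀ v : H, ‖X (Y v)‖ ≤ ‖X (X v)‖ + ‖Y (Y v)‖ := by
      intro v
      have h3 : (inner ℂ (X (Y v)) (X (Y v)) : ℂ) = inner ℂ (X (X v)) (Y (Y v)) := by
        rw [h.symm_left (X v), h.comm (Y v), ← h.symm_right, h.comm]
      have h4 : ‖X (Y v)‖ ^ 2 = ‖(inner ℂ (X (X v)) (Y (Y v)) : ℂ)‖ := by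
        rw [← h3, inner_self_eq_norm_sq_to_K]
        simp
      have h5 := norm_inner_le_norm (𝕜 := ℂ) (X (X v)) (Y (Y v))
      refine abs_le_of_sq_le_sq' ?_ (by positivity) |>.2
      nlinarith [norm_nonneg (X (X v)), norm_nonneg (Y (Y v))]
    have hcau : CauchySeq fun k => X (Y (u k)) := by
      rw [Metric.cauchySeq_iff']
      intro ε hε
      obtain ⟨M1, hM1⟩ := Metric.cauchySeq_iff.1 h1.cauchySeq (ε / 2) (half_pos hε)
      obtain ⟨M2, hM2⟩ := Metric.cauchySeq_iff.1 h2.cauchySeq (ε / 2) (half_pos hε)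
      refine ⟨max M1 M2, fun n hn => ?_⟩
      have e1 := hM1 n (le_trans (le_max_left _ _) hn) _ (le_max_left M1 M2)
      have e2 := hM2 n (le_trans (le_max_right _ _) hn) _ (le_max_right M1 M2)
      have e3 := hbound (u n - u (max M1 M2))
      rw [dist_eq_norm] at e1 e2 ⊢
      simp only [map_sub] at e3
      linarith
    obtain ⟨e, he⟩ := cauchySeq_tendsto_of_complete hcau
    refine ⟨e, ?_, ?_⟩
    · refine tendsto_nhds_unique ((Y.continuous.tendsto _).comp h1) ?_
      refine ((X.continuous.tendsto _).comp he).congr fun k => ?_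
      simp [h.comm]
    · refine tendsto_nhds_unique ((Y.continuous.tendsto _).comp he) ?_
      refine ((X.continuous.tendsto _).comp h2).congr fun k => ?_
      simp [h.comm]
  · rintro ⟨e, h1, h2⟩
    rw [h1, ← h.comm, h2]

lemma graph_sq (h : IsCommutingPair X Y) :
    ((pairOperator (X * X) (Y * Y)).graph : SetRel H H) =
      SetRel.comp ((pairOperator X Y).graph : SetRel H H) (pairOperator X Y).graph := by
  ext ⟨c, d⟩
  rw [SetLike.mem_coe, h.sq.mem_graph]
  change Y (Y c) = X (X d) ↔ ∃ e, (c, e) ∈ (pairOperator X Y).graph ∧ (e, d) ∈ (pairOperator X Y).graph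
  simp only [h.mem_graph]
  exact h.exists_mid

end IsCommutingPair

end CommutingPairs

/-! ### Square roots of unbounded operators and polar decompositions -/

section PolarDecomposition

variable {H : Type*} [NormedAddCommGroup H] [InnerProductSpace ℂ H] [CompleteSpace H]

namespace IsPositiveSelfAdjoint

variable {T : H →ₗ.[ℂ] H}

lemma mem_graph_iff (hT : IsPositiveSelfAdjoint T) {c d : H} :
    (c, d) ∈ T.graph ↔ ∀ a b, (a, b) ∈ T.graph → inner ℂ b c = (inner ℂ a d : ℂ) := by
  have h : T.graph = T.graph.adjoint := by
    rw [← LinearPMap.adjoint_graph_eq_graph_adjoint hT.dense,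
      LinearPMap.isSelfAdjoint_def.1 hT.selfAdjoint]
  rw [h, Submodule.mem_adjoint_iff]
  simp only [sub_eq_zero, ← h]

lemma inner_nonneg (hT : IsPositiveSelfAdjoint T) {a b : H} (h : (a, b) ∈ T.graph) :
    0 ≤ (inner ℂ a b : ℂ).re := by
  obtain ⟨x, rfl, rfl⟩ := LinearPMap.mem_graph_iff _ |>.1 h
  exact hT.nonneg x

lemma isClosed_graph (hT : IsPositiveSelfAdjoint T) : IsClosed (T.graph : Set (H × H)) :=
  hT.selfAdjoint.isClosed

/-- Only the zero vector is an eigenvector of `T²` with eigenvalue `-1`. -/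
lemma eq_zero_of_sq_eq_neg (hT : IsPositiveSelfAdjoint T) {a b : H} (h1 : (a, b) ∈ T.graph)
    (h2 : (b, -a) ∈ T.graph) : a = 0 := by
  have h := hT.mem_graph_iff.1 h2 a b h1
  rw [inner_neg_right, inner_self_eq_norm_sq_to_K, inner_self_eq_norm_sq_to_K] at h
  have h' : ‖b‖ ^ 2 = -‖a‖ ^ 2 := by exact_mod_cast h
  have h'' : ‖a‖ ^ 2 = 0 := by nlinarith [sq_nonneg ‖a‖, sq_nonneg ‖b‖]
  simpa using h''

/-- The resolvent `B = (1 + T²)⁻¹` and `K = T B`, obtained from the orthogonal projection of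
`(x, 0)` onto the graph of `T`. -/
lemma exists_resolvent (hT : IsPositiveSelfAdjoint T) :
    ∃ B K : H →L[ℂ] H, ∀ x, (B x, K x) ∈ T.graph ∧ (K x, x - B x) ∈ T.graph := by
  let e := WithLp.prodContinuousLinearEquiv 2 ℂ H H
  let G : Submodule ℂ (WithLp 2 (H × H)) := T.graph.comap e.toLinearMap
  have hG : IsClosed (G : Set (WithLp 2 (H × H))) := hT.isClosed_graph.preimage e.continuous
  have : CompleteSpace G := hG.completeSpace_coe
  let L : H →L[ℂ] H × H := (e : WithLp 2 (H × H) →L[ℂ] H × H) ∘L G.starProjection ∘L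
    (e.symm : H × H →L[ℂ] WithLp 2 (H × H)) ∘L ContinuousLinearMap.inl ℂ H H
  refine ⟨ContinuousLinearMap.fst ℂ H H ∘L L, ContinuousLinearMap.snd ℂ H H ∘L L, fun x => ?_⟩
  have h1 : L x ∈ T.graph := G.starProjection_apply_mem (e.symm (x, 0))
  refine ⟨h1, hT.mem_graph_iff.2 fun a b hab => ?_⟩
  have h2 := G.starProjection_inner_eq_zero (e.symm (x, 0)) (e.symm (a, b)) (by
    change e (e.symm (a, b)) ∈ T.graph
    rwa [e.apply_symm_apply])
  rw [WithLp.prod_inner_apply] at h2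
  change (inner ℂ (x - (L x).1) a + inner ℂ (0 - (L x).2) b : ℂ) = 0 at h2
  rw [zero_sub, inner_neg_left, ← sub_eq_add_neg, sub_eq_zero] at h2
  change (inner ℂ b (L x).2 : ℂ) = inner ℂ a (x - (L x).1)
  rw [← inner_conj_symm, ← h2, inner_conj_symm]

/-- A positive self-adjoint operator is determined by its square.  The square of `T` determines
`B = (1 + T²)⁻¹`, hence `K = T B` as the positive square root of `B - B²`, and the vectors
`(B u, K u)` are dense in the graph of `T`. -/
theorem eq_of_sq_eq {T₁ T₂ : H →ₗ.[ℂ] H} (h₁ : IsPositiveSelfAdjoint T₁)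
    (h₂ : IsPositiveSelfAdjoint T₂)
    (h : SetRel.comp (T₁.graph : SetRel H H) (T₁.graph : SetRel H H) =
      SetRel.comp (T₂.graph : SetRel H H) (T₂.graph : SetRel H H)) : T₁ = T₂ := by
  have huniq : ∀ {T : H →ₗ.[ℂ] H}, IsPositiveSelfAdjoint T → ∀ {x a b a' b' : H},
      (a, b) ∈ T.graph → (b, x - a) ∈ T.graph → (a', b') ∈ T.graph → (b', x - a') ∈ T.graph →
      a = a' ∧ b = b' := by
    intro T hT x a b a' b' h1 h2 h3 h4
    have e1 : (a - a', b - b') ∈ T.graph := sub_mem h1 h3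
    have e2 : (b - b', -(a - a')) ∈ T.graph := by
      convert sub_mem h2 h4 using 1
      ext
      · rfl
      · simp only [Prod.snd_sub]; abel
    have e3 := hT.eq_zero_of_sq_eq_neg e1 e2
    refine ⟨sub_eq_zero.1 e3, sub_eq_zero.1 ?_⟩
    exact T.graph_fst_eq_zero_snd e1 e3
  have hpos : ∀ {T : H →ₗ.[ℂ] H}, IsPositiveSelfAdjoint T → ∀ {B K : H →L[ℂ] H},
      (∀ x, (B x, K x) ∈ T.graph ∧ (K x, x - B x) ∈ T.graph) →
      0 ≤ K ∧ K * K = B - B * B := by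
    intro T hT B K hBK
    constructor
    · rw [ContinuousLinearMap.nonneg_iff_isPositive, ContinuousLinearMap.isPositive_def]
      refine ⟨fun x y => ?_, fun x => ?_⟩
      · have e1 := hT.mem_graph_iff.1 (hBK y).1 _ _ (hBK x).1
        have e2 := hT.mem_graph_iff.1 (hBK y).2 _ _ (hBK x).2
        change (inner ℂ (K x) y : ℂ) = inner ℂ x (K y)
        rw [inner_sub_right, inner_sub_left, e1] at e2
        linear_combination -e2
      · have e1 := hT.inner_nonneg (hBK x).1
        have e2 := hT.inner_nonneg (hBK x).2
        rw [inner_sub_right, Complex.sub_re] at e2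
        rw [ContinuousLinearMap.reApplyInnerSelf_apply]
        have e3 : (inner ℂ (K x) (B x) : ℂ).re = (inner ℂ (B x) (K x) : ℂ).re :=
          inner_re_symm (𝕜 := ℂ) _ _
        change 0 ≤ (inner ℂ (K x) x : ℂ).re
        linarith
    · ext x
      exact (huniq hT (hBK (K x)).1 (hBK (K x)).2 (hBK (B x)).2
        (sub_mem (hBK x).1 (hBK (B x)).1)).2
  obtain ⟨B₁, K₁, hK₁⟩ := h₁.exists_resolvent
  obtain ⟨B₂, K₂, hK₂⟩ := h₂.exists_resolvent
  have hB : B₁ = B₂ := by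
    ext x
    have hx : (B₂ x, x - B₂ x) ∈ SetRel.comp (T₁.graph : SetRel H H) (T₁.graph : SetRel H H) := by
      rw [h]
      exact ⟨K₂ x, hK₂ x⟩
    obtain ⟨b, hb1, hb2⟩ := hx
    exact (huniq h₁ (hK₁ x).1 (hK₁ x).2 hb1 hb2).1
  have hK : K₁ = K₂ := by
    obtain ⟨p1, s1⟩ := hpos h₁ hK₁
    obtain ⟨p2, s2⟩ := hpos h₂ hK₂
    rw [← CFC.mul_self_eq_mul_self_iff K₁ K₂, s1, s2, hB]
  have hcore : ∀ {T : H →ₗ.[ℂ] H}, IsPositiveSelfAdjoint T → ∀ {B K : H →L[ℂ] H},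
      (∀ x, (B x, K x) ∈ T.graph ∧ (K x, x - B x) ∈ T.graph) →
      T.graph = (LinearMap.range (B.prod K).toLinearMap).topologicalClosure := by
    intro T hT B K hBK
    have hle : LinearMap.range (B.prod K).toLinearMap ≤ T.graph := by
      rintro _ ⟨u, rfl⟩
      exact (hBK u).1
    refine le_antisymm (le_topologicalClosure_of_orthogonal hle hT.isClosed_graph ?_)
      (Submodule.topologicalClosure_minimal _ hle hT.isClosed_graph)
    rintro ⟨c, d⟩ hcd hz
    have hc : c = 0 := by
      refine ext_inner_left ℂ fun u => ?_
      have e1 := hz (B u, K u) ⟨u, rfl⟩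
      have e2 := hT.mem_graph_iff.1 hcd _ _ (hBK u).2
      simp only at e1
      rw [inner_sub_left] at e2
      rw [inner_zero_right]
      linear_combination e1 + e2
    have hd : d = 0 := T.graph_fst_eq_zero_snd hcd hc
    rw [hc, hd]
    rfl
  refine LinearPMap.eq_of_eq_graph ?_
  rw [hcore h₁ hK₁, hcore h₂ hK₂, hB, hK]

end IsPositiveSelfAdjoint

namespace IsPolarDecomposition

variable {S : SetRel H H} {J : H ≃ₗᵢ⋆[ℂ] H} {T : H →ₗ.[ℂ] H}

lemma mem_iff (h : IsPolarDecomposition S J T) {a b : H} :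
    (a, b) ∈ S ↔ (a, J.symm b) ∈ T.graph := by
  rw [h.graph_eq, LinearPMap.mem_graph_iff]
  constructor
  · rintro ⟨x, hx⟩
    obtain ⟨rfl, rfl⟩ := Prod.ext_iff.1 hx
    exact ⟨x, rfl, by simp⟩
  · rintro ⟨x, rfl, hx⟩
    exact ⟨x, by simp [show T x = J.symm b from hx]⟩

lemma mem_adjoint_iff (h : IsPolarDecomposition S J T) {a b : H} :
    (a, b) ∈ antilinearAdjoint S ↔ (J.symm a, b) ∈ T.graph := by
  rw [h.positive.mem_graph_iff]
  constructor
  · intro hab x y hxy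
    have := hab (x, J y) (h.mem_iff.2 (by simpa using hxy))
    rw [← inner_conj_symm, antiunitary_inner_symm_left, this, inner_conj_symm]
  · rintro hab ⟨x, y⟩ hxy
    have := hab _ _ (h.mem_iff.1 hxy)
    change (inner ℂ y a : ℂ) = inner ℂ b x
    rw [← inner_conj_symm b, ← this, inner_conj_symm, antiunitary_inner_symm_left,
      J.apply_symm_apply]

/-- If `S = J T` is a polar decomposition, then `S* S = T²`. -/
lemma comp_adjoint (h : IsPolarDecomposition S J T) :
    S.comp (antilinearAdjoint S) = SetRel.comp (T.graph : SetRel H H) (T.graph : SetRel H H) := by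
  ext ⟨a, c⟩
  constructor
  · rintro ⟨b, h1, h2⟩
    exact ⟨J.symm b, h.mem_iff.1 h1, h.mem_adjoint_iff.1 h2⟩
  · rintro ⟨b, h1, h2⟩
    exact ⟨J b, h.mem_iff.2 (by simpa using h1), h.mem_adjoint_iff.2 (by simpa using h2)⟩

/-- Uniqueness of the polar decomposition. -/
theorem unique {J' : H ≃ₗᵢ⋆[ℂ] H} {T' : H →ₗ.[ℂ] H} (h : IsPolarDecomposition S J T)
    (h' : IsPolarDecomposition S J' T') (hT : Dense {d | ∃ c, (c, d) ∈ T.graph}) :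
    J' = J ∧ T' = T := by
  have hTT : T' = T :=
    h'.positive.eq_of_sq_eq h.positive (h'.comp_adjoint.symm.trans h.comp_adjoint)
  subst hTT
  refine ⟨LinearIsometryEquiv.ext fun d => ?_, rfl⟩
  refine hT.induction (P := fun d => J' d = J d) ?_
    (isClosed_eq J'.continuous J.continuous) d
  rintro d ⟨c, hcd⟩
  have h1 : (c, J d) ∈ S := h.mem_iff.2 (by simpa using hcd)
  have h2 : (c, J'.symm (J d)) ∈ T'.graph := h'.mem_iff.1 h1
  have h3 : J'.symm (J d) = d := T'.mem_graph_snd_inj h2 hcd rfl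
  rw [← h3, J'.apply_symm_apply, h3]

end IsPolarDecomposition

end PolarDecomposition

/-! ### Antiunitary operators with prescribed values on a total family -/

section Gram

variable {H : Type*} [NormedAddCommGroup H] [InnerProductSpace ℂ H] [CompleteSpace H]

/-- Two total families with complex conjugate Gram matrices are related by an antiunitary
operator. -/
theorem exists_antiunitary_of_gram {ι : Type*} (v w : ι → H)
    (hv : (Submodule.span ℂ (Set.range v)).topologicalClosure = ⊤)
    (hw : (Submodule.span ℂ (Set.range w)).topologicalClosure = ⊤)
    (h : ∀ i k, inner ℂ (w i) (w k) = (inner ℂ (v k) (v i) : ℂ)) :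
    ∃ J : H ≃ₗᵢ⋆[ℂ] H, ∀ i, J (v i) = w i := by
  let A : (ι →₀ ℂ) →ₗ[ℂ] H := Finsupp.linearCombination ℂ v
  let C : (ι →₀ ℂ) →ₗ⋆[ℂ] H :=
    { toFun := fun f => f.sum fun i c => conj c • w i
      map_add' := fun f g => Finsupp.sum_add_index' (by simp) (by simp [add_smul])
      map_smul' := fun c f => by
        rw [Finsupp.sum_smul_index (by simp), Finsupp.smul_sum]
        simp [mul_smul] }
  have hA : DenseRange A := by
    rw [DenseRange, ← LinearMap.coe_range, Submodule.dense_iff_topologicalClosure_eq_top,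
      Finsupp.range_linearCombination, hv]
  have hC : DenseRange C := by
    have : Dense (Submodule.span ℂ (Set.range w) : Set H) :=
      (Submodule.dense_iff_topologicalClosure_eq_top).2 hw
    refine this.mono ?_
    intro x hx
    rw [← Finsupp.range_linearCombination] at hx
    obtain ⟨f, rfl⟩ := hx
    refine ⟨f.mapRange conj (map_zero _), ?_⟩
    change (f.mapRange conj (map_zero _)).sum (fun i c => conj c • w i) = _
    rw [Finsupp.sum_mapRange_index (by simp)]
    simp [Finsupp.linearCombination_apply]
  have hCA : ∀ f, ‖C f‖ = ‖A f‖ := by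
    intro f
    have h1 : (inner ℂ (C f) (C f) : ℂ) = inner ℂ (A f) (A f) := by
      have e1 : (inner ℂ (C f) (C f) : ℂ) =
          ∑ i ∈ f.support, ∑ k ∈ f.support, f i * conj (f k) * inner ℂ (v k) (v i) := by
        change inner ℂ (∑ i ∈ f.support, conj (f i) • w i) (∑ i ∈ f.support, conj (f i) • w i) = _
        simp only [sum_inner, inner_sum, inner_smul_left, inner_smul_right, h, Complex.conj_conj,
          Finset.mul_sum, mul_assoc]
        rw [Finset.sum_comm]
        refine Finset.sum_congr rfl fun i _ => Finset.sum_congr rfl fun k _ => ?_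
        ring
      have e2 : (inner ℂ (A f) (A f) : ℂ) =
          ∑ i ∈ f.support, ∑ k ∈ f.support, f i * conj (f k) * inner ℂ (v k) (v i) := by
        change inner ℂ (∑ i ∈ f.support, f i • v i) (∑ i ∈ f.support, f i • v i) = _
        simp only [sum_inner, inner_sum, inner_smul_left, inner_smul_right, Finset.mul_sum,
          mul_assoc]
      rw [e1, e2]
    rw [inner_self_eq_norm_sq_to_K, inner_self_eq_norm_sq_to_K] at h1
    have h2 : ‖C f‖ ^ 2 = ‖A f‖ ^ 2 := by exact_mod_cast h1
    exact (pow_left_inj₀ (norm_nonneg _) (norm_nonneg _) two_ne_zero).1 h2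
  obtain ⟨J, hJ⟩ := exists_antiunitary_extension A C hA hC hCA
  refine ⟨J, fun i => ?_⟩
  have h1 : A (Finsupp.single i 1) = v i := by simp [A]
  have h2 : C (Finsupp.single i 1) = w i := by simp [C]
  rw [← h1, hJ, h2]

/-- A symmetric operator with bounded orbits is a contraction: the sequence `‖Mᵏ x‖` is
logarithmically convex. -/
lemma norm_le_of_symmetric_of_bounded_orbits {V : Type*} [NormedAddCommGroup V]
    [InnerProductSpace ℂ V] (M : V →ₗ[ℂ] V)
    (hM : ∀ u v, inner ℂ (M u) v = (inner ℂ u (M v) : ℂ))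
    (hb : ∀ u, ∃ C : ℝ, ∀ k : ℕ, ‖(M ^ k) u‖ ≤ C) (u : V) : ‖M u‖ ≤ ‖u‖ := by
  by_contra! hlt
  have hconv : ∀ v, ‖M v‖ ^ 2 ≤ ‖v‖ * ‖M (M v)‖ := by
    intro v
    have h1 : ‖M v‖ ^ 2 = ‖(inner ℂ v (M (M v)) : ℂ)‖ := by
      rw [← hM, inner_self_eq_norm_sq_to_K]
      simp
    rw [h1]
    exact norm_inner_le_norm _ _
  have hMu : 0 < ‖M u‖ := (norm_nonneg u).trans_lt hlt
  have hu : 0 < ‖u‖ := by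
    rw [norm_pos_iff]
    rintro rfl
    simp at hMu
  set r := ‖M u‖ / ‖u‖ with hr
  have hr1 : 1 < r := (one_lt_div hu).2 hlt
  have hgrow : ∀ k : ℕ, 0 < ‖(M ^ k) u‖ ∧ r * ‖(M ^ k) u‖ ≤ ‖(M ^ (k + 1)) u‖ := by
    intro k
    induction k with
    | zero =>
      refine ⟨by simpa using hu, ?_⟩
      simp [hr, hu.ne']
    | succ k ih =>
      have hpos : 0 < ‖(M ^ (k + 1)) u‖ := (mul_pos (by linarith) ih.1).trans_le ih.2
      refine ⟨hpos, ?_⟩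
      have h1 := hconv ((M ^ k) u)
      rw [← Module.End.mul_apply, ← Module.End.mul_apply, ← pow_succ', ← pow_succ'] at h1
      have h2 : r * ‖(M ^ k) u‖ * ‖(M ^ (k + 1)) u‖ ≤ ‖(M ^ k) u‖ * ‖(M ^ (k + 1 + 1)) u‖ := by
        nlinarith [ih.2]
      have h3 : ‖(M ^ k) u‖ * (r * ‖(M ^ (k + 1)) u‖) ≤ ‖(M ^ k) u‖ * ‖(M ^ (k + 1 + 1)) u‖ := by
        linarith
      exact le_of_mul_le_mul_left h3 ih.1
  obtain ⟨C, hC⟩ := hb u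
  have hpow : ∀ k : ℕ, r ^ k * ‖u‖ ≤ ‖(M ^ k) u‖ := by
    intro k
    induction k with
    | zero => simp
    | succ k ih =>
      refine le_trans ?_ (hgrow k).2
      rw [pow_succ', mul_assoc]
      exact mul_le_mul_of_nonneg_left ih (by linarith)
  obtain ⟨k, hk⟩ := pow_unbounded_of_one_lt (C / ‖u‖) hr1
  rw [div_lt_iff₀ hu] at hk
  linarith [hpow k, hC k]

end Gram

/-! ### Creation and annihilation operators -/

noncomputable section FockOperators

variable {E : Type*} [NormedAddCommGroup E] [InnerProductSpace ℂ E]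

lemma creation_coe (p : E) (x : ExteriorAlgebra ℂ E) :
    creation p (x : FockSpace E) = ((ExteriorAlgebra.ι ℂ p * x : ExteriorAlgebra ℂ E)) := by
  rw [creation, ContinuousLinearMap.completion_apply_coe]
  rfl

lemma annihilation_coe (p : E) (x : ExteriorAlgebra ℂ E) :
    annihilation p (x : FockSpace E) = ((algAnnihilation p x : ExteriorAlgebra ℂ E)) := by
  rw [annihilation, ContinuousLinearMap.completion_apply_coe]
  rfl

lemma inner_creation_left (p : E) (v w : FockSpace E) :
    inner ℂ (creation p v) w = (inner ℂ v (annihilation p w) : ℂ) := by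
  induction v, w using UniformSpace.Completion.induction_on₂ with
  | hp => exact isClosed_eq (by fun_prop) (by fun_prop)
  | ih x y =>
    rw [creation_coe, annihilation_coe, UniformSpace.Completion.inner_coe,
      UniformSpace.Completion.inner_coe, inner_exterior_eq, inner_exterior_eq, fockForm_ι_mul_left]

lemma inner_annihilation_left (p : E) (v w : FockSpace E) :
    inner ℂ (annihilation p v) w = (inner ℂ v (creation p w) : ℂ) := by
  rw [← inner_conj_symm, ← inner_creation_left, inner_conj_symm]

lemma annihilation_creation (p q : E) (v : FockSpace E) :
    annihilation p (creation q v) = (inner ℂ p q : ℂ) • v - creation q (annihilation p v) := by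
  induction v using UniformSpace.Completion.induction_on with
  | hp =>
    have h : Continuous fun v : FockSpace E =>
        (inner ℂ p q : ℂ) • v - creation q (annihilation p v) :=
      (continuous_const_smul _).sub ((creation q).continuous.comp (annihilation p).continuous)
    exact isClosed_eq (by fun_prop) h
  | ih x =>
    simp only [creation_coe, annihilation_coe, algAnnihilation_ι_mul,
      UniformSpace.Completion.coe_sub, UniformSpace.Completion.coe_smul]

lemma creation_creation (p q : E) (v : FockSpace E) :
    creation p (creation q v) = -creation q (creation p v) := by
  induction v using UniformSpace.Completion.induction_on with
  | hp => exact isClosed_eq (by fun_prop) (by fun_prop)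
  | ih x =>
    rw [creation_coe, creation_coe, creation_coe, creation_coe, ← UniformSpace.Completion.coe_neg,
      ← mul_assoc, ← mul_assoc,
      eq_neg_of_add_eq_zero_left (ExteriorAlgebra.ι_add_mul_swap (R := ℂ) p q), neg_mul]

lemma annihilation_annihilation (p q : E) (v : FockSpace E) :
    annihilation p (annihilation q v) = -annihilation q (annihilation p v) := by
  refine ext_inner_left ℂ fun w => ?_
  rw [← inner_creation_left, ← inner_creation_left, creation_creation, inner_neg_right,
    ← inner_creation_left, ← inner_creation_left, inner_neg_left]

lemma annihilation_vacuum (p : E) : annihilation p (vacuum E) = 0 := by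
  rw [vacuum, annihilation_coe, algAnnihilation_one, UniformSpace.Completion.coe_zero]

lemma creation_vacuum (p : E) : creation p (vacuum E) = oneParticle p := by
  rw [vacuum, creation_coe, mul_one, oneParticle]

lemma creation_sub (p q : E) (v : FockSpace E) :
    creation (p - q) v = creation p v - creation q v := by
  refine UniformSpace.Completion.induction_on v (isClosed_eq (by fun_prop) (by fun_prop)) fun x => ?_
  simp only [creation_coe, map_sub, sub_mul, UniformSpace.Completion.coe_sub]

lemma norm_creation_le (p : E) (v : FockSpace E) : ‖creation p v‖ ≤ ‖p‖ * ‖v‖ := by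
  have h : (inner ℂ (creation p v) (creation p v) + inner ℂ (annihilation p v) (annihilation p v) : ℂ) =
      inner ℂ p p * inner ℂ v v := by
    rw [inner_creation_left, inner_annihilation_left, annihilation_creation, inner_sub_right,
      inner_smul_right]
    ring
  simp only [inner_self_eq_norm_sq_to_K] at h
  have h' : ‖creation p v‖ ^ 2 + ‖annihilation p v‖ ^ 2 = (‖p‖ * ‖v‖) ^ 2 := by
    rw [mul_pow]
    exact_mod_cast h
  refine abs_le_of_sq_le_sq' ?_ (by positivity) |>.2
  nlinarith [sq_nonneg ‖annihilation p v‖]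

lemma continuous_creation_apply (v : FockSpace E) : Continuous fun p : E => creation p v := by
  refine (LipschitzWith.of_dist_le_mul (K := ‖v‖₊) fun p q => ?_).continuous
  rw [dist_eq_norm, dist_eq_norm, ← creation_sub, mul_comm]
  exact norm_creation_le _ _

lemma wedge_zero (p : Fin 0 → E) : wedge 0 p = vacuum E := by
  rw [wedge, ExteriorAlgebra.ιMulti_zero_apply, vacuum]

lemma wedge_succ (n : ℕ) (p : Fin (n + 1) → E) :
    wedge (n + 1) p = creation (p 0) (wedge n fun i => p i.succ) := by
  rw [wedge, ExteriorAlgebra.ιMulti_succ_apply, wedge, creation_coe]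
  rfl

lemma wedge_one (p : Fin 1 → E) : wedge 1 p = oneParticle (p 0) := by
  rw [wedge_succ, wedge_zero, creation_vacuum]

/-- A closed subspace that contains the vacuum and is invariant under the creation operators of a
dense set of vectors is the whole Fock space. -/
lemma eq_top_of_creation_mem {W : Submodule ℂ (FockSpace E)} (hW : IsClosed (W : Set (FockSpace E)))
    (h1 : vacuum E ∈ W) {D : Set E} (hD : Dense D) (h2 : ∀ p ∈ D, ∀ v ∈ W, creation p v ∈ W) :
    W = ⊤ := by
  have h3 : ∀ p, ∀ v ∈ W, creation p v ∈ W := by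
    intro p v hv
    refine hD.induction (P := fun p => creation p v ∈ W) (fun p hp => h2 p hp v hv) ?_ p
    exact hW.preimage (continuous_creation_apply v)
  rw [eq_top_iff]
  intro v _
  refine UniformSpace.Completion.induction_on v hW fun x => ?_
  induction x using exterior_induction_left with
  | one => exact h1
  | add a b ha hb => rw [UniformSpace.Completion.coe_add]; exact add_mem ha hb
  | smul c a ha => rw [UniformSpace.Completion.coe_smul]; exact W.smul_mem c ha
  | ι_mul p a ha => rw [← creation_coe]; exact h3 p _ ha

/-- The products of vectors from a dense set are total in Fock space. -/
lemma span_wedge_topologicalClosure {D : Set E} (hD : Dense D) :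
    (Submodule.span ℂ {ψ | ∃ (n : ℕ) (p : Fin n → E), (∀ i, p i ∈ D) ∧
      ψ = wedge n p}).topologicalClosure = ⊤ := by
  set S := Submodule.span ℂ {ψ | ∃ (n : ℕ) (p : Fin n → E), (∀ i, p i ∈ D) ∧ ψ = wedge n p}
  refine eq_top_of_creation_mem S.isClosed_topologicalClosure ?_ hD ?_
  · exact S.le_topologicalClosure
      (Submodule.subset_span ⟨0, Fin.elim0, fun i => i.elim0, (wedge_zero _).symm⟩)
  · intro p hp v hv
    have hle : S ≤ S.comap (creation p).toLinearMap := by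
      refine Submodule.span_le.2 ?_
      rintro _ ⟨n, q, hq, rfl⟩
      refine Submodule.subset_span ⟨n + 1, Fin.cons p q, ?_, ?_⟩
      · intro i
        refine Fin.cases ?_ (fun i => ?_) i
        · simpa using hp
        · simpa using hq i
      · rw [wedge_succ]
        simp
    have hle' : S.topologicalClosure ≤ S.topologicalClosure.comap (creation p).toLinearMap := by
      refine S.topologicalClosure_minimal (hle.trans (Submodule.comap_mono S.le_topologicalClosure)) ?_
      exact S.isClosed_topologicalClosure.preimage (creation p).continuous
    exact hle' hv

/-! ### Second quantization of symmetric contractions -/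

/-- A linear contraction that is symmetric for the inner product; the underlying space need not be
complete. -/
structure IsSymmContraction (A : E →L[ℂ] E) : Prop where
  symm : ∀ u v, inner ℂ (A u) v = (inner ℂ u (A v) : ℂ)
  norm_le : ∀ u, ‖A u‖ ≤ ‖u‖

lemma algAnnihilation_map {A : E →L[ℂ] E} (hA : IsSymmContraction A) (p : E)
    (x : ExteriorAlgebra ℂ E) :
    algAnnihilation p (ExteriorAlgebra.map A.toLinearMap x) =
      ExteriorAlgebra.map A.toLinearMap (algAnnihilation (A p) x) := by
  induction x using exterior_induction_left with
  | one => simp [algAnnihilation_one]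
  | add a b ha hb => simp only [map_add, ha, hb]
  | smul c a ha => simp only [map_smul, ha]
  | ι_mul q a ha =>
    rw [map_mul, ExteriorAlgebra.map_apply_ι, algAnnihilation_ι_mul, algAnnihilation_ι_mul, ha,
      map_sub, map_mul, map_smul, ExteriorAlgebra.map_apply_ι, hA.symm]
    rfl

lemma fockForm_map {A : E →L[ℂ] E} (hA : IsSymmContraction A) (x y : ExteriorAlgebra ℂ E) :
    fockForm (ExteriorAlgebra.map A.toLinearMap x) y =
      fockForm x (ExteriorAlgebra.map A.toLinearMap y) := by
  induction y using exterior_induction_left generalizing x with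
  | one =>
    rw [map_one, fockForm_one_right, fockForm_one_right]
    congr 1
    induction x using exterior_induction_left with
    | one => simp
    | add a b ha hb => simp only [map_add, ha, hb]
    | smul c a ha => simp only [map_smul, ha]
    | ι_mul q a ha => simp [ExteriorAlgebra.algebraMapInv]
  | add a b ha hb => simp only [map_add, fockForm_add_right, ha, hb]
  | smul c a ha => simp only [map_smul, fockForm_smul_right, ha]
  | ι_mul q a ha =>
    rw [fockForm_ι_mul_right, algAnnihilation_map hA, ha, map_mul, ExteriorAlgebra.map_apply_ι,
      fockForm_ι_mul_right]
    rfl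

/-- On exterior algebras a symmetric contraction induces a contraction.  The orbit of a product
of `n` factors under its powers is bounded by the product of the norms of the factors, so
`norm_le_of_symmetric_of_bounded_orbits` applies. -/
lemma norm_map_le {A : E →L[ℂ] E} (hA : IsSymmContraction A) (x : ExteriorAlgebra ℂ E) :
    ‖ExteriorAlgebra.map A.toLinearMap x‖ ≤ ‖x‖ := by
  refine norm_le_of_symmetric_of_bounded_orbits (ExteriorAlgebra.map A.toLinearMap).toLinearMap
    (fockForm_map hA) (fun y => ?_) x
  have hpow : ∀ (k : ℕ) (y : ExteriorAlgebra ℂ E),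
      ((ExteriorAlgebra.map A.toLinearMap).toLinearMap ^ k) y =
        ExteriorAlgebra.map (A.toLinearMap ^ k) y := by
    intro k
    induction k with
    | zero =>
      intro y
      rw [pow_zero, pow_zero, Module.End.one_eq_id, Module.End.one_eq_id, ExteriorAlgebra.map_id]
      rfl
    | succ k ih =>
      intro y
      rw [pow_succ, pow_succ, Module.End.mul_apply, ih, Module.End.mul_eq_comp,
        ← ExteriorAlgebra.map_comp_map]
      rfl
  simp only [hpow]
  have hAk : ∀ (k : ℕ) (u : E), ‖(A.toLinearMap ^ k) u‖ ≤ ‖u‖ := by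
    intro k
    induction k with
    | zero => simp
    | succ k ih =>
      intro u
      rw [pow_succ, Module.End.mul_apply]
      exact (ih _).trans (hA.norm_le u)
  induction y using exterior_induction_left with
  | one => exact ⟨‖(1 : ExteriorAlgebra ℂ E)‖, fun k => by rw [map_one]⟩
  | add a b ha hb =>
    obtain ⟨C, hC⟩ := ha
    obtain ⟨D, hD⟩ := hb
    exact ⟨C + D, fun k => by rw [map_add]; exact (norm_add_le _ _).trans (add_le_add (hC k) (hD k))⟩
  | smul c a ha =>
    obtain ⟨C, hC⟩ := ha
    exact ⟨‖c‖ * C, fun k => by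
      rw [map_smul, norm_smul]
      exact mul_le_mul_of_nonneg_left (hC k) (norm_nonneg _)⟩
  | ι_mul p a ha =>
    obtain ⟨C, hC⟩ := ha
    refine ⟨‖p‖ * C, fun k => ?_⟩
    rw [map_mul, ExteriorAlgebra.map_apply_ι, ← UniformSpace.Completion.norm_coe, ← creation_coe]
    refine (norm_creation_le _ _).trans ?_
    rw [UniformSpace.Completion.norm_coe]
    exact mul_le_mul (hAk k p) (hC k) (norm_nonneg _) (norm_nonneg _)

/-- The second quantization `Γ(A) (p₁ ∧ … ∧ pₙ) = A p₁ ∧ … ∧ A pₙ` of a symmetric contraction. -/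
def secondQuant {A : E →L[ℂ] E} (hA : IsSymmContraction A) : FockSpace E →L[ℂ] FockSpace E :=
  ((ExteriorAlgebra.map A.toLinearMap).toLinearMap.mkContinuous 1 fun x => by
    rw [one_mul]
    exact norm_map_le hA x).completion

variable {A B C : E →L[ℂ] E}

lemma secondQuant_coe (hA : IsSymmContraction A) (x : ExteriorAlgebra ℂ E) :
    secondQuant hA (x : FockSpace E) = (ExteriorAlgebra.map A.toLinearMap x : ExteriorAlgebra ℂ E) := by
  rw [secondQuant, ContinuousLinearMap.completion_apply_coe]
  rfl

lemma secondQuant_creation (hA : IsSymmContraction A) (p : E) (v : FockSpace E) :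
    secondQuant hA (creation p v) = creation (A p) (secondQuant hA v) := by
  refine UniformSpace.Completion.induction_on v (isClosed_eq (by fun_prop) (by fun_prop)) fun x => ?_
  simp only [creation_coe, secondQuant_coe, map_mul, ExteriorAlgebra.map_apply_ι]
  rfl

lemma secondQuant_vacuum (hA : IsSymmContraction A) : secondQuant hA (vacuum E) = vacuum E := by
  rw [vacuum, secondQuant_coe, map_one]

lemma secondQuant_wedge (hA : IsSymmContraction A) (n : ℕ) (p : Fin n → E) :
    secondQuant hA (wedge n p) = wedge n fun i => A (p i) := by
  rw [wedge, secondQuant_coe, ExteriorAlgebra.map_apply_ιMulti, wedge]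
  rfl

lemma secondQuant_oneParticle (hA : IsSymmContraction A) (p : E) :
    secondQuant hA (oneParticle p) = oneParticle (A p) := by
  rw [← creation_vacuum, secondQuant_creation, secondQuant_vacuum, creation_vacuum]

lemma inner_secondQuant (hA : IsSymmContraction A) (v w : FockSpace E) :
    inner ℂ (secondQuant hA v) w = (inner ℂ v (secondQuant hA w) : ℂ) := by
  induction v, w using UniformSpace.Completion.induction_on₂ with
  | hp => exact isClosed_eq (by fun_prop) (by fun_prop)
  | ih x y =>
    rw [secondQuant_coe, secondQuant_coe, UniformSpace.Completion.inner_coe,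
      UniformSpace.Completion.inner_coe, inner_exterior_eq, inner_exterior_eq, fockForm_map hA]

lemma secondQuant_comp (hA : IsSymmContraction A) (hB : IsSymmContraction B)
    (hC : IsSymmContraction C) (h : ∀ u, A (B u) = C u) (v : FockSpace E) :
    secondQuant hA (secondQuant hB v) = secondQuant hC v := by
  refine UniformSpace.Completion.induction_on v (isClosed_eq (by fun_prop) (by fun_prop)) fun x => ?_
  simp only [secondQuant_coe]
  rw [← AlgHom.comp_apply, ExteriorAlgebra.map_comp_map]
  congr 4
  ext u
  exact h u

lemma denseRange_secondQuant (hA : IsSymmContraction A) (h : DenseRange A) :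
    DenseRange (secondQuant hA) := by
  set W := (LinearMap.range (secondQuant hA).toLinearMap).topologicalClosure with hW
  have htop : W = ⊤ := by
    refine eq_top_of_creation_mem (Submodule.isClosed_topologicalClosure _) ?_ h ?_
    · exact Submodule.le_topologicalClosure _ ⟨vacuum E, secondQuant_vacuum hA⟩
    · rintro _ ⟨u, rfl⟩ v hv
      have hle : W ≤ W.comap (creation (A u)).toLinearMap := by
        refine Submodule.topologicalClosure_minimal _ ?_
          ((Submodule.isClosed_topologicalClosure _).preimage (creation (A u)).continuous)
        rintro _ ⟨w, rfl⟩
        exact Submodule.le_topologicalClosure _ ⟨creation u w, secondQuant_creation hA u w⟩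
      exact hle hv
  intro v
  have : v ∈ W := htop ▸ Submodule.mem_top
  exact this

lemma secondQuant_injective (hA : IsSymmContraction A) (h : DenseRange A) (v : FockSpace E)
    (hv : secondQuant hA v = 0) : v = 0 := by
  refine (denseRange_secondQuant hA h).eq_zero_of_inner_left ℂ ?_
  intro w
  rw [← inner_secondQuant, hv, inner_zero_left]

lemma isSymmContraction_neg_one : IsSymmContraction (-1 : E →L[ℂ] E) where
  symm u v := by simp
  norm_le u := by simp

/-- The parity operator `(-1)^N`. -/
def parity (E : Type*) [NormedAddCommGroup E] [InnerProductSpace ℂ E] :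
    FockSpace E →L[ℂ] FockSpace E :=
  secondQuant (isSymmContraction_neg_one (E := E))

lemma parity_creation (p : E) (v : FockSpace E) :
    parity E (creation p v) = -creation p (parity E v) := by
  have h : creation (-p) (parity E v) = -creation p (parity E v) := by
    have := creation_sub 0 p (parity E v)
    have h0 := creation_sub p p (parity E v)
    rw [sub_self, sub_self] at h0
    rwa [zero_sub, h0, zero_sub] at this
  rw [parity, secondQuant_creation, ← parity]
  exact h

lemma parity_vacuum : parity E (vacuum E) = vacuum E := secondQuant_vacuum _

lemma parity_parity (v : FockSpace E) : parity E (parity E v) = v := by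
  have hone : IsSymmContraction (1 : E →L[ℂ] E) := ⟨fun _ _ => rfl, fun _ => le_rfl⟩
  rw [parity, secondQuant_comp _ _ hone (by simp)]
  refine UniformSpace.Completion.induction_on v (isClosed_eq (by fun_prop) (by fun_prop)) fun x => ?_
  rw [secondQuant_coe]
  change ((ExteriorAlgebra.map LinearMap.id x : ExteriorAlgebra ℂ E) : FockSpace E) = _
  rw [ExteriorAlgebra.map_id]
  rfl

lemma inner_parity (v w : FockSpace E) :
    inner ℂ (parity E v) w = (inner ℂ v (parity E w) : ℂ) := inner_secondQuant _ v w

lemma parity_annihilation (p : E) (v : FockSpace E) :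
    parity E (annihilation p v) = -annihilation p (parity E v) := by
  refine ext_inner_left ℂ fun w => ?_
  rw [← inner_parity, ← inner_creation_left, inner_neg_right, ← inner_creation_left, ← inner_parity,
    parity_creation, inner_neg_left, neg_neg]

/-- `p₁ ∧ … ∧ pₙ₊₁` as a right multiplication by its last factor. -/
lemma wedge_succ_last (n : ℕ) (p : Fin (n + 1) → E) :
    wedge (n + 1) p = creation (p (Fin.last n)) (parity E (wedge n fun i => p i.castSucc)) := by
  induction n with
  | zero => rw [wedge_succ, wedge_zero, wedge_zero, parity_vacuum]; rfl
  | succ n ih =>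
    rw [wedge_succ, ih, wedge_succ n, parity_creation, map_neg, creation_creation]
    rfl

end FockOperators

/-! ### Gram matrices of wedge products and particle number subspaces -/

noncomputable section ParticleNumber

variable {E : Type*} [NormedAddCommGroup E] [InnerProductSpace ℂ E]

lemma inner_vacuum_vacuum : (inner ℂ (vacuum E) (vacuum E) : ℂ) = 1 := by
  rw [vacuum, UniformSpace.Completion.inner_coe, inner_exterior_eq, fockForm_one_left, map_one]

lemma annihilation_wedge_succ (v : E) (n : ℕ) (q : Fin (n + 1) → E) :
    annihilation v (wedge (n + 1) q) =
      ∑ k : Fin (n + 1), ((-1) ^ (k : ℕ) * inner ℂ v (q k) : ℂ) •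
        wedge n fun i => q (k.succAbove i) := by
  induction n with
  | zero =>
    rw [wedge_succ, wedge_zero, annihilation_creation, annihilation_vacuum]
    simp [wedge_zero]
  | succ n ih =>
    rw [wedge_succ, annihilation_creation, ih, sub_eq_add_neg]
    conv_rhs => rw [Fin.sum_univ_succ]
    congr 1
    · simp
    · rw [map_sum, ← Finset.sum_neg_distrib]
      refine Finset.sum_congr rfl fun k _ => ?_
      rw [wedge_succ, map_smul, ← neg_smul]
      simp [pow_succ]

lemma inner_wedge (n : ℕ) (p q : Fin n → E) :
    inner ℂ (wedge n p) (wedge n q) = (Matrix.of fun i k => (inner ℂ (p i) (q k) : ℂ)).det := by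
  induction n with
  | zero => rw [wedge_zero, wedge_zero, inner_vacuum_vacuum, Matrix.det_fin_zero]
  | succ n ih =>
    rw [wedge_succ n p, inner_creation_left, annihilation_wedge_succ, inner_sum,
      Matrix.det_succ_row_zero]
    refine Finset.sum_congr rfl fun k _ => ?_
    rw [inner_smul_right, ih]
    rfl

lemma inner_wedge_of_ne {n m : ℕ} (h : n ≠ m) (p : Fin n → E) (q : Fin m → E) :
    (inner ℂ (wedge n p) (wedge m q) : ℂ) = 0 := by
  induction n generalizing m with
  | zero =>
    obtain ⟨m, rfl⟩ := Nat.exists_eq_succ_of_ne_zero h.symm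
    rw [wedge_zero, wedge_succ, ← inner_annihilation_left, annihilation_vacuum, inner_zero_left]
  | succ n ih =>
    rw [wedge_succ n p, inner_creation_left]
    cases m with
    | zero => rw [wedge_zero, annihilation_vacuum, inner_zero_right]
    | succ m =>
      rw [annihilation_wedge_succ, inner_sum]
      refine Finset.sum_eq_zero fun k _ => ?_
      rw [inner_smul_right, ih (by omega), mul_zero]

/-- The second quantization of an antiunitary operator, combined with the reversal of the order of
the factors. -/
theorem exists_antiunitary_wedge (j : E ≃ₗᵢ⋆[ℂ] E) :
    ∃ J : FockSpace E ≃ₗᵢ⋆[ℂ] FockSpace E,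
      ∀ n (p : Fin n → E), J (wedge n p) = wedge n fun i => j (p i.rev) := by
  have htot := span_wedge_topologicalClosure (E := E) (D := Set.univ) dense_univ
  have h1 : {ψ : FockSpace E | ∃ (n : ℕ) (p : Fin n → E), (∀ i, p i ∈ Set.univ) ∧ ψ = wedge n p} =
      Set.range fun a : (Σ n, Fin n → E) => wedge a.1 a.2 := by
    ext ψ
    simp [eq_comm]
  have h2 : {ψ : FockSpace E | ∃ (n : ℕ) (p : Fin n → E), (∀ i, p i ∈ Set.univ) ∧ ψ = wedge n p} =
      Set.range fun a : (Σ n, Fin n → E) => wedge a.1 fun i => j (a.2 i.rev) := by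
    rw [h1]
    ext ψ
    constructor
    · rintro ⟨⟨n, p⟩, rfl⟩
      exact ⟨⟨n, fun i => j.symm (p i.rev)⟩, by simp⟩
    · rintro ⟨⟨n, p⟩, rfl⟩
      exact ⟨⟨n, fun i => j (p i.rev)⟩, rfl⟩
  obtain ⟨J, hJ⟩ := exists_antiunitary_of_gram
    (fun a : (Σ n, Fin n → E) => wedge a.1 a.2)
    (fun a : (Σ n, Fin n → E) => wedge a.1 fun i => j (a.2 i.rev))
    (by rw [← h1, htot]) (by rw [← h2, htot]) (by
      rintro ⟨n, p⟩ ⟨m, q⟩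
      by_cases hnm : n = m
      · subst hnm
        simp only [inner_wedge, antiunitary_inner_map_map]
        rw [← Matrix.det_transpose, ← Matrix.det_submatrix_equiv_self (Fin.revPerm (n := n))]
        congr 1
        ext i k
        simp
      · simp only
        rw [inner_wedge_of_ne hnm, inner_wedge_of_ne (Ne.symm hnm)])
  exact ⟨J, fun n p => hJ ⟨n, p⟩⟩

lemma wedge_mem_nParticle (n : ℕ) (p : Fin n → E) : wedge n p ∈ nParticle E n :=
  Submodule.le_topologicalClosure _ (Submodule.subset_span ⟨p, rfl⟩)

lemma map_mem_nParticle {σ : ℂ →+* ℂ} (T : FockSpace E →SL[σ] FockSpace E) {n m : ℕ}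
    (h : ∀ p, T (wedge n p) ∈ nParticle E m) {ψ : FockSpace E} (hψ : ψ ∈ nParticle E n) :
    T ψ ∈ nParticle E m := by
  have hle : nParticle E n ≤ (nParticle E m).comap T.toLinearMap := by
    refine Submodule.topologicalClosure_minimal _ (Submodule.span_le.2 ?_) ?_
    · rintro _ ⟨p, rfl⟩
      exact h p
    · exact (Submodule.isClosed_topologicalClosure _).preimage T.continuous
  exact hle hψ

lemma secondQuant_starProjection {A : E →L[ℂ] E} (hA : IsSymmContraction A) (n : ℕ)
    (ψ : FockSpace E) : secondQuant hA ((nParticle E n).starProjection ψ) =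
      (nParticle E n).starProjection (secondQuant hA ψ) := by
  have hmem : ∀ φ ∈ nParticle E n, secondQuant hA φ ∈ nParticle E n := fun φ hφ =>
    map_mem_nParticle (secondQuant hA)
      (fun p => by rw [secondQuant_wedge]; exact wedge_mem_nParticle _ _) hφ
  refine (Submodule.eq_starProjection_of_mem_of_inner_eq_zero
    (hmem _ (Submodule.starProjection_apply_mem _ _)) fun φ hφ => ?_).symm
  rw [← map_sub, inner_secondQuant]
  exact Submodule.starProjection_inner_eq_zero _ _ (hmem φ hφ)

lemma antiunitary_starProjection {j : E ≃ₗᵢ⋆[ℂ] E} {J : FockSpace E ≃ₗᵢ⋆[ℂ] FockSpace E}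
    (hJ : ∀ n (p : Fin n → E), J (wedge n p) = wedge n fun i => j (p i.rev)) (n : ℕ)
    (ψ : FockSpace E) :
    J ((nParticle E n).starProjection ψ) = (nParticle E n).starProjection (J ψ) := by
  have hmem : ∀ φ ∈ nParticle E n, J φ ∈ nParticle E n := fun φ hφ =>
    map_mem_nParticle (J : FockSpace E →SL[starRingEnd ℂ] FockSpace E)
      (fun p => by
        change J (wedge n p) ∈ _
        rw [hJ]
        exact wedge_mem_nParticle _ _) hφ
  have hmem' : ∀ φ ∈ nParticle E n, J.symm φ ∈ nParticle E n := fun φ hφ =>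
    map_mem_nParticle (J.symm : FockSpace E →SL[starRingEnd ℂ] FockSpace E)
      (fun p => by
        have : J.symm (wedge n p) = wedge n fun i => j.symm (p i.rev) := by
          rw [J.symm_apply_eq, hJ]
          simp
        change J.symm (wedge n p) ∈ _
        rw [this]
        exact wedge_mem_nParticle _ _) hφ
  refine (Submodule.eq_starProjection_of_mem_of_inner_eq_zero
    (hmem _ (Submodule.starProjection_apply_mem _ _)) fun φ hφ => ?_).symm
  rw [← map_sub, ← J.apply_symm_apply φ, antiunitary_inner_map_map, ← inner_conj_symm,
    Submodule.starProjection_inner_eq_zero _ _ (hmem' φ hφ), map_zero]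

lemma inner_oneParticle (p q : E) : inner ℂ (oneParticle p) (oneParticle q) = (inner ℂ p q : ℂ) := by
  rw [← creation_vacuum, ← creation_vacuum, inner_creation_left, annihilation_creation,
    annihilation_vacuum, map_zero, sub_zero, inner_smul_right, inner_vacuum_vacuum, mul_one]

/-- The isometric embedding of the one-particle space. -/
def oneParticleIsometry : E →ₗᵢ[ℂ] FockSpace E :=
  LinearMap.isometryOfInner
    { toFun := oneParticle
      map_add' := fun p q => by simp [oneParticle, UniformSpace.Completion.coe_add]
      map_smul' := fun c p => by simp [oneParticle, UniformSpace.Completion.coe_smul] }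
    inner_oneParticle

lemma oneParticle_injective : Function.Injective (oneParticle (E := E)) :=
  oneParticleIsometry.injective

lemma mem_nParticle_one [CompleteSpace E] {ψ : FockSpace E} :
    ψ ∈ nParticle E 1 ↔ ∃ p, ψ = oneParticle p := by
  constructor
  · intro h
    have hcl : IsClosed (LinearMap.range (oneParticleIsometry (E := E)).toLinearMap :
        Set (FockSpace E)) :=
      oneParticleIsometry.isometry.isClosedEmbedding.isClosed_range
    have hle : nParticle E 1 ≤ LinearMap.range (oneParticleIsometry (E := E)).toLinearMap := by
      refine Submodule.topologicalClosure_minimal _ (Submodule.span_le.2 ?_) hcl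
      rintro _ ⟨p, rfl⟩
      exact ⟨p 0, (wedge_one p).symm⟩
    obtain ⟨p, hp⟩ := hle h
    exact ⟨p, hp.symm⟩
  · rintro ⟨p, rfl⟩
    rw [← wedge_one fun _ => p]
    exact wedge_mem_nParticle _ _

end ParticleNumber

/-! ### Wick products -/

noncomputable section Wick

variable {E : Type*} [NormedAddCommGroup E] [InnerProductSpace ℂ E]

/-- Repeated application of operators `l (p i)` to the vacuum. -/
def iterCreation (l : E → FockSpace E →L[ℂ] FockSpace E) : ∀ n : ℕ, (Fin n → E) → FockSpace E
  | 0, _ => vacuum E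
  | n + 1, p => l (p 0) (iterCreation l n fun i => p i.succ)

/-- Creation and annihilation operators `c`, `a` satisfying the anticommutation relations between
`a` and `c`, acting on Fock space with the usual one-particle vectors. -/
structure IsFockAction (c a : E → FockSpace E →L[ℂ] FockSpace E) : Prop where
  anticomm : ∀ t s v, a t (c s v) = (inner ℂ t s : ℂ) • v - c s (a t v)
  inner_left : ∀ s v w, inner ℂ (c s v) w = (inner ℂ v (a s w) : ℂ)
  annihilate : ∀ t, a t (vacuum E) = 0
  create : ∀ s, c s (vacuum E) = oneParticle s

/-- Wick products.  Let `l`, `l'` and `r`, `r'` be two systems of creation and annihilation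
operators, and consider triples `(s, t, m)` such that the algebra `𝔞` contains `l s + l' t`, while
`r t + r' m` commutes with the adjoints of its elements.  Then some `A` in `𝔞` satisfies
`A Ω = l s₁ ⋯ l sₙ Ω` and `A* Ω = r t₁ ⋯ r tₙ Ω` simultaneously.

The product is built up one factor at a time: if `A Ω = x` and `A* Ω = y`, then
`(l s + l' t) A Ω = l s x + l' t x`, whereas
`A* (l t + l' s) Ω = A* (r t + r' m) Ω = r t y + r' m y`.  The surplus pair `(l' t x, r' m y)` is
subtracted, being realised by an element of `𝔞` as well; to ensure the latter, the induction
carries a set `W` of realised pairs that is stable under these contractions. -/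
theorem exists_wick {l l' r r' : E → FockSpace E →L[ℂ] FockSpace E} (hl : IsFockAction l l')
    (hr : IsFockAction r r') (D : Set (E × E × E))
    (hD : ∀ d ∈ D, ∀ d' ∈ D, inner ℂ d.2.2 d'.2.1 = (inner ℂ d'.1 d.2.1 : ℂ))
    (𝔞 : Subalgebra ℂ (FockSpace E →L[ℂ] FockSpace E))
    (hmem : ∀ d ∈ D, l d.1 + l' d.2.1 ∈ 𝔞)
    (hcomm : ∀ A ∈ 𝔞, ∀ d ∈ D, ∀ v, ContinuousLinearMap.adjoint A ((r d.2.1 + r' d.2.2) v) =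
      (r d.2.1 + r' d.2.2) (ContinuousLinearMap.adjoint A v))
    (n : ℕ) (p : Fin n → E × E × E) (hp : ∀ i, p i ∈ D) :
    ∃ A ∈ 𝔞, A (vacuum E) = iterCreation l n (fun i => (p i).1) ∧
      ContinuousLinearMap.adjoint A (vacuum E) = iterCreation r n (fun i => (p i).2.1) := by
  have hadj : ∀ s t, ContinuousLinearMap.adjoint (l s + l' t) = l t + l' s := by
    intro s t
    refine (ContinuousLinearMap.eq_adjoint_iff _ _).2 (fun v w => ?_) |>.symm
    have h : ∀ v w, inner ℂ (l' s v) w = (inner ℂ v (l s w) : ℂ) := fun v w => by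
      rw [← inner_conj_symm, ← hl.inner_left, inner_conj_symm]
    simp only [add_apply, inner_add_left, inner_add_right, hl.inner_left, h]
    rw [add_comm]
  suffices h : ∃ W : Set (FockSpace E × FockSpace E),
      (∀ z ∈ W, ∃ A ∈ 𝔞, A (vacuum E) = z.1 ∧ ContinuousLinearMap.adjoint A (vacuum E) = z.2) ∧
      (iterCreation l n (fun i => (p i).1), iterCreation r n (fun i => (p i).2.1)) ∈ W ∧
      (∀ z ∈ W, ∀ w ∈ W, z + w ∈ W) ∧ (∀ (c : ℂ), ∀ z ∈ W, (c • z.1, conj c • z.2) ∈ W) ∧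
      (∀ d ∈ D, ∀ z ∈ W, (l' d.2.1 z.1, r' d.2.2 z.2) ∈ W) by
    obtain ⟨W, h1, h2, -⟩ := h
    exact h1 _ h2
  induction n with
  | zero =>
    refine ⟨{z | ∃ c : ℂ, z = (c • vacuum E, conj c • vacuum E)}, ?_, ⟨1, by simp [iterCreation]⟩,
      ?_, ?_, ?_⟩
    · rintro _ ⟨c, rfl⟩
      refine ⟨c • 1, Subalgebra.smul_mem _ (one_mem _) c, by simp, ?_⟩
      rw [map_smulₛₗ, ← ContinuousLinearMap.star_eq_adjoint, star_one]
      simp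
    · rintro _ ⟨c, rfl⟩ _ ⟨d, rfl⟩
      exact ⟨c + d, by simp [add_smul]⟩
    · rintro c _ ⟨d, rfl⟩
      exact ⟨c * d, by simp [mul_smul]⟩
    · rintro d _ _ ⟨c, rfl⟩
      exact ⟨0, by simp [hl.annihilate, hr.annihilate]⟩
  | succ n ih =>
    obtain ⟨W, hW, hpW, hadd, hsmul, hcontr⟩ := ih (fun i => p i.succ) fun i => hp i.succ
    obtain ⟨⟨s, t, m⟩, hstm⟩ : ∃ d, d = p 0 := ⟨_, rfl⟩
    have hd : (s, t, m) ∈ D := hstm ▸ hp 0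
    -- the contraction with `d` of `(l s w₁, r t w₂)` is `⟪t_d, s⟫ w₁ - l s (l' t_d w₁)` in the first
    -- entry, and the conjugate combination in the second, so it stays in the set of such sums
    refine ⟨{z | ∃ u ∈ W, ∃ w ∈ W, z = (u.1 + l s w.1, u.2 + r t w.2)}, ?_, ?_, ?_, ?_, ?_⟩
    · rintro _ ⟨u, hu, w, hw, rfl⟩
      obtain ⟨A, hA, hA1, hA2⟩ := hW u hu
      obtain ⟨B, hB, hB1, hB2⟩ := hW w hw
      obtain ⟨C, hC, hC1, hC2⟩ := hW _ (hcontr _ hd w hw)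
      refine ⟨A + (l s + l' t) * B - C, sub_mem (add_mem hA (mul_mem (hmem _ hd) hB)) hC, ?_, ?_⟩
      · simp only [sub_apply, add_apply,
          ContinuousLinearMap.mul_def, ContinuousLinearMap.comp_apply, hA1, hB1, hC1]
        abel
      · have h1 : ContinuousLinearMap.adjoint ((l s + l' t) * B) (vacuum E) =
            r t w.2 + r' m w.2 := by
          rw [← ContinuousLinearMap.star_eq_adjoint, star_mul, ContinuousLinearMap.star_eq_adjoint,
            ContinuousLinearMap.star_eq_adjoint, hadj, ContinuousLinearMap.mul_def,
            ContinuousLinearMap.comp_apply]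
          have h2 : (l t + l' s) (vacuum E) = (r t + r' m) (vacuum E) := by
            simp [hl.annihilate, hr.annihilate, hl.create, hr.create]
          rw [h2, hcomm B hB _ hd, hB2]
          rfl
        rw [map_sub, map_add, sub_apply, add_apply, h1, hA2, hC2]
        change u.2 + (r t w.2 + r' m w.2) - r' m w.2 = u.2 + r t w.2
        abel
    · refine ⟨(0, 0), ?_, _, hpW, ?_⟩
      · simpa using hsmul 0 _ hpW
      · simp [iterCreation, ← hstm]
    · rintro _ ⟨u, hu, w, hw, rfl⟩ _ ⟨u', hu', w', hw', rfl⟩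
      refine ⟨u + u', hadd _ hu _ hu', w + w', hadd _ hw _ hw', ?_⟩
      ext1
      · simp only [Prod.fst_add, map_add]; abel
      · simp only [Prod.snd_add, map_add]; abel
    · rintro c _ ⟨u, hu, w, hw, rfl⟩
      exact ⟨_, hsmul c u hu, _, hsmul c w hw, by simp⟩
    · rintro ⟨s₀, t₀, m₀⟩ hd₀ _ ⟨u, hu, w, hw, rfl⟩
      refine ⟨_, hadd _ (hcontr _ hd₀ u hu) _ (hsmul (inner ℂ t₀ s) w hw), _,
        hsmul (-1) _ (hcontr _ hd₀ w hw), ?_⟩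
      have h1 : conj (inner ℂ t₀ s : ℂ) = inner ℂ m₀ t := by
        rw [inner_conj_symm]
        exact (hD _ hd₀ _ hd).symm
      ext1
      · simp [hl.anticomm]
        abel
      · simp only [h1]
        simp [hr.anticomm]
        abel

lemma isFockAction_left : IsFockAction (creation (E := E)) annihilation where
  anticomm := annihilation_creation
  inner_left := inner_creation_left
  annihilate := annihilation_vacuum
  create := creation_vacuum

/-- Creation by multiplication from the right, `ψ ↦ ψ ∧ s`. -/
def rightCreation (s : E) : FockSpace E →L[ℂ] FockSpace E := creation s ∘L parity E

/-- The adjoint of `rightCreation`. -/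
def rightAnnihilation (s : E) : FockSpace E →L[ℂ] FockSpace E := parity E ∘L annihilation s

lemma isFockAction_right : IsFockAction (rightCreation (E := E)) rightAnnihilation where
  anticomm t s v := by
    simp only [rightCreation, rightAnnihilation, ContinuousLinearMap.comp_apply,
      annihilation_creation, map_sub, map_smul, parity_parity, parity_annihilation, parity_creation,
      map_neg]
  inner_left s v w := by
    simp only [rightCreation, rightAnnihilation, ContinuousLinearMap.comp_apply]
    rw [inner_creation_left, inner_parity]
  annihilate t := by simp [rightAnnihilation, annihilation_vacuum]
  create s := by simp [rightCreation, parity_vacuum, creation_vacuum]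

lemma iterCreation_left (n : ℕ) (p : Fin n → E) : iterCreation creation n p = wedge n p := by
  induction n with
  | zero => rw [iterCreation, wedge_zero]
  | succ n ih => rw [iterCreation, wedge_succ, ih]

lemma iterCreation_right (n : ℕ) (p : Fin n → E) :
    iterCreation rightCreation n p = wedge n fun i => p i.rev := by
  induction n with
  | zero => rw [iterCreation, wedge_zero]
  | succ n ih =>
    rw [iterCreation, ih, wedge_succ_last]
    simp [rightCreation, Fin.rev_castSucc]

/-- The field operator `c(s)^* + c(t)`. -/
def leftField (s t : E) : FockSpace E →L[ℂ] FockSpace E := creation s + annihilation t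

/-- The twisted field operator, acting from the right. -/
def rightField (s t : E) : FockSpace E →L[ℂ] FockSpace E := rightCreation s + rightAnnihilation t

lemma leftField_mul_rightField {s t s' t' : E} (h : inner ℂ t s' = (inner ℂ t' s : ℂ)) :
    leftField s t * rightField s' t' = rightField s' t' * leftField s t := by
  ext v
  simp only [leftField, rightField, rightCreation, rightAnnihilation,
    ContinuousLinearMap.mul_def, ContinuousLinearMap.comp_apply, add_apply, ContinuousLinearMap.comp_apply,
    parity_annihilation, parity_creation, map_add, map_neg, annihilation_creation, map_sub, map_smul,
    h, creation_creation s s', annihilation_annihilation t t']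
  abel

lemma adjoint_leftField (s t : E) :
    ContinuousLinearMap.adjoint (leftField s t) = leftField t s := by
  refine (ContinuousLinearMap.eq_adjoint_iff _ _).2 (fun v w => ?_) |>.symm
  simp only [leftField, add_apply, inner_add_left, inner_add_right,
    inner_creation_left, inner_annihilation_left]
  rw [add_comm]

lemma adjoint_rightField (s t : E) :
    ContinuousLinearMap.adjoint (rightField s t) = rightField t s := by
  refine (ContinuousLinearMap.eq_adjoint_iff _ _).2 (fun v w => ?_) |>.symm
  simp only [rightField, rightCreation, rightAnnihilation, add_apply,
    inner_add_left, inner_add_right, ContinuousLinearMap.comp_apply, inner_creation_left,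
    inner_parity, inner_annihilation_left]
  rw [add_comm]

lemma antilinearAdjoint_swap {R : SetRel E E} (hR : ∀ a b, (a, b) ∈ R → (b, a) ∈ R) {a b : E}
    (h : (a, b) ∈ antilinearAdjoint R) : (b, a) ∈ antilinearAdjoint R := by
  rintro ⟨c, d⟩ hcd
  have := h (d, c) (hR _ _ hcd)
  change (inner ℂ c a : ℂ) = inner ℂ b d at this
  change (inner ℂ d b : ℂ) = inner ℂ a c
  rw [← inner_conj_symm, ← this, inner_conj_symm]

/-- The field operators belonging to an antilinear relation on the one-particle space. -/
def fieldSet (R : SetRel E E) : Set (FockSpace E →L[ℂ] FockSpace E) :=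
  {L | ∃ z ∈ R, L = leftField z.1 z.2}

lemma rightField_mem_centralizer {R : SetRel E E} {s t : E} (h : (s, t) ∈ antilinearAdjoint R) :
    rightField s t ∈ Set.centralizer (fieldSet R) := by
  rintro _ ⟨z, hz, rfl⟩
  exact leftField_mul_rightField (h z hz)

lemma commute_adjoint {A B : FockSpace E →L[ℂ] FockSpace E} (h : A * B = B * A) (v : FockSpace E) :
    ContinuousLinearMap.adjoint A (ContinuousLinearMap.adjoint B v) =
      ContinuousLinearMap.adjoint B (ContinuousLinearMap.adjoint A v) := by
  have := congrArg star h
  rw [star_mul, star_mul] at this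
  exact (DFunLike.congr_fun this v).symm

/-- Wick products in the von Neumann algebra of a symmetric antilinear relation. -/
theorem exists_wick_left {R : SetRel E E} (hR : ∀ a b, (a, b) ∈ R → (b, a) ∈ R) (n : ℕ)
    (s t m : Fin n → E) (hst : ∀ i, (s i, t i) ∈ R) (htm : ∀ i, (t i, m i) ∈ antilinearAdjoint R) :
    ∃ A ∈ Set.centralizer (Set.centralizer (fieldSet R)), A (vacuum E) = wedge n s ∧
      ContinuousLinearMap.adjoint A (vacuum E) = wedge n fun i => t i.rev := by
  obtain ⟨A, hA, hA1, hA2⟩ := exists_wick isFockAction_left isFockAction_right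
    {d : E × E × E | (d.1, d.2.1) ∈ R ∧ (d.2.1, d.2.2) ∈ antilinearAdjoint R}
    (fun d hd d' hd' => (hd.2 _ (hR _ _ hd'.1)).symm)
    (Subalgebra.centralizer ℂ (Set.centralizer (fieldSet R)))
    (fun d hd => Set.subset_centralizer_centralizer ⟨_, hd.1, rfl⟩)
    (fun A hA d hd v => by
      have h := hA _ (rightField_mem_centralizer (antilinearAdjoint_swap hR hd.2))
      have h' := commute_adjoint h v
      rw [adjoint_rightField] at h'
      exact h'.symm)
    n (fun i => (s i, t i, m i)) fun i => ⟨hst i, htm i⟩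
  refine ⟨A, hA, ?_, ?_⟩
  · rw [hA1, iterCreation_left]
  · rw [hA2, iterCreation_right]

/-- Wick products in the commutant. -/
theorem exists_wick_right {R : SetRel E E} (hR : ∀ a b, (a, b) ∈ R → (b, a) ∈ R) (n : ℕ)
    (s t m : Fin n → E) (hst : ∀ i, (s i, t i) ∈ antilinearAdjoint R)
    (htm : ∀ i, (t i, m i) ∈ R) :
    ∃ A ∈ Set.centralizer (fieldSet R), A (vacuum E) = (wedge n fun i => s i.rev) ∧
      ContinuousLinearMap.adjoint A (vacuum E) = wedge n t := by
  obtain ⟨A, hA, hA1, hA2⟩ := exists_wick isFockAction_right isFockAction_left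
    {d : E × E × E | (d.1, d.2.1) ∈ antilinearAdjoint R ∧ (d.2.1, d.2.2) ∈ R}
    (fun d hd d' hd' => antilinearAdjoint_swap hR hd'.1 _ hd.2)
    (Subalgebra.centralizer ℂ (fieldSet R))
    (fun d hd => rightField_mem_centralizer hd.1)
    (fun A hA d hd v => by
      have h := hA _ ⟨_, hR _ _ hd.2, rfl⟩
      have h' := commute_adjoint h v
      rw [adjoint_leftField] at h'
      exact h'.symm)
    n (fun i => (s i, t i, m i)) fun i => ⟨hst i, htm i⟩
  refine ⟨A, hA, ?_, ?_⟩
  · rw [hA1, iterCreation_right]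
  · rw [hA2, iterCreation_left]

end Wick

/-! ### The one-particle structure -/

section OneParticle

/-- The polar decomposition `R = j x⁻¹ y` of an antilinear relation, expressed by commuting
bounded operators `x = (1 + R* R)^{-1/2}` and `y = (1 - x²)^{1/2}`; the operator `g` is a square root
of `x y`. -/
structure IsPolarData {E : Type*} [NormedAddCommGroup E] [InnerProductSpace ℂ E] (R : SetRel E E)
    (x y g : E →L[ℂ] E) (j : E ≃ₗᵢ⋆[ℂ] E) : Prop where
  pair : IsCommutingPair x y
  contr_left : IsSymmContraction x
  contr_right : IsSymmContraction y
  contr_sqrt : IsSymmContraction g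
  injective_right : ∀ u, y u = 0 → u = 0
  sq_add_sq : ∀ u, x (x u) + y (y u) = u
  sqrt_mul_sqrt : ∀ u, g (g u) = x (y u)
  mem_iff : ∀ a b, (a, b) ∈ R ↔ y a = x (j.symm b)
  symm : ∀ a b, (a, b) ∈ R → (b, a) ∈ R

lemma inner_self_eq_ofReal {E : Type*} [NormedAddCommGroup E] [InnerProductSpace ℂ E] (v : E) :
    (inner ℂ v v : ℂ) = ((‖v‖ ^ 2 : ℝ) : ℂ) := by
  rw [inner_self_eq_norm_sq_to_K]
  norm_cast

/-- Commuting square roots of a positive contraction `b` and of `1 - b`. -/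
lemma exists_commuting_sqrt {E : Type*} [NormedAddCommGroup E] [InnerProductSpace ℂ E]
    [CompleteSpace E] (b : E →L[ℂ] E) (hb0 : 0 ≤ b) (hb1 : 0 ≤ 1 - b)
    (hinj : ∀ u, b u = 0 → u = 0) :
    ∃ x y g : E →L[ℂ] E, IsCommutingPair x y ∧ IsSymmContraction x ∧ IsSymmContraction y ∧
      IsSymmContraction g ∧ (∀ u, x (x u) = b u) ∧ (∀ u, y (y u) = u - b u) ∧
      ∀ u, g (g u) = x (y u) := by
  have hx0 : 0 ≤ CFC.sqrt b := CFC.sqrt_nonneg b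
  have hy0 : 0 ≤ CFC.sqrt (1 - b) := CFC.sqrt_nonneg _
  have hx : ∀ u, CFC.sqrt b (CFC.sqrt b u) = b u := fun u =>
    DFunLike.congr_fun (CFC.sqrt_mul_sqrt_self b hb0) u
  have hy : ∀ u, CFC.sqrt (1 - b) (CFC.sqrt (1 - b) u) = u - b u := fun u =>
    DFunLike.congr_fun (CFC.sqrt_mul_sqrt_self (1 - b) hb1) u
  have hcomm : Commute (CFC.sqrt b) (CFC.sqrt (1 - b)) := by
    have h1 : Commute b (1 - b) := (Commute.one_right b).sub_right (Commute.refl b)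
    have h2 : Commute (CFC.sqrt b) (1 - b) := h1.cfcₙ_nnreal _
    exact (h2.symm.cfcₙ_nnreal _).symm
  have hxy0 : 0 ≤ CFC.sqrt b * CFC.sqrt (1 - b) := hcomm.mul_nonneg hx0 hy0
  have hsymm : ∀ {a : E →L[ℂ] E}, 0 ≤ a → ∀ u v, inner ℂ (a u) v = (inner ℂ u (a v) : ℂ) := by
    intro a ha u v
    exact ((ContinuousLinearMap.nonneg_iff_isPositive a).1 ha).isSymmetric u v
  have hnorm : ∀ u, ‖CFC.sqrt b u‖ ^ 2 + ‖CFC.sqrt (1 - b) u‖ ^ 2 = ‖u‖ ^ 2 := by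
    intro u
    have h1 : (inner ℂ (CFC.sqrt b u) (CFC.sqrt b u) +
        inner ℂ (CFC.sqrt (1 - b) u) (CFC.sqrt (1 - b) u) : ℂ) = inner ℂ u u := by
      rw [hsymm hx0, hsymm hy0, hx, hy, ← inner_add_right, add_sub_cancel]
    simp only [inner_self_eq_norm_sq_to_K] at h1
    exact_mod_cast h1
  have hxc : ∀ u, ‖CFC.sqrt b u‖ ≤ ‖u‖ := fun u =>
    abs_le_of_sq_le_sq' (by nlinarith [hnorm u, sq_nonneg ‖CFC.sqrt (1 - b) u‖]) (norm_nonneg _) |>.2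
  have hyc : ∀ u, ‖CFC.sqrt (1 - b) u‖ ≤ ‖u‖ := fun u =>
    abs_le_of_sq_le_sq' (by nlinarith [hnorm u, sq_nonneg ‖CFC.sqrt b u‖]) (norm_nonneg _) |>.2
  have hg0 := CFC.sqrt_nonneg (CFC.sqrt b * CFC.sqrt (1 - b))
  have hg : ∀ u, CFC.sqrt (CFC.sqrt b * CFC.sqrt (1 - b))
      (CFC.sqrt (CFC.sqrt b * CFC.sqrt (1 - b)) u) = CFC.sqrt b (CFC.sqrt (1 - b) u) := fun u =>
    DFunLike.congr_fun (CFC.sqrt_mul_sqrt_self _ hxy0) u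
  refine ⟨CFC.sqrt b, CFC.sqrt (1 - b), CFC.sqrt (CFC.sqrt b * CFC.sqrt (1 - b)),
    ⟨hsymm hx0, hsymm hy0, fun u => DFunLike.congr_fun hcomm.eq u, fun u hu => hinj u ?_⟩,
    ⟨hsymm hx0, hxc⟩, ⟨hsymm hy0, hyc⟩, ⟨hsymm hg0, fun u => ?_⟩, hx, hy, hg⟩
  · rw [← hx, hu, map_zero]
  · have h1 : ‖CFC.sqrt (CFC.sqrt b * CFC.sqrt (1 - b)) u‖ ^ 2 =
        ‖(inner ℂ u (CFC.sqrt b (CFC.sqrt (1 - b) u)) : ℂ)‖ := by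
      rw [← hg, ← hsymm hg0, inner_self_eq_norm_sq_to_K]
      simp
    have h2 := norm_inner_le_norm (𝕜 := ℂ) u (CFC.sqrt b (CFC.sqrt (1 - b) u))
    have h3 := (hxc (CFC.sqrt (1 - b) u)).trans (hyc u)
    refine abs_le_of_sq_le_sq' ?_ (norm_nonneg _) |>.2
    nlinarith [norm_nonneg u]

variable {𝓱 : Type*} [NormedAddCommGroup 𝓱] [InnerProductSpace ℂ 𝓱]

lemma isClosed_of_hasOrthogonalProjection (K : Submodule ℂ 𝓱) [K.HasOrthogonalProjection] :
    IsClosed (K : Set 𝓱) := by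
  have : (K : Set 𝓱) = {v | K.starProjection v = v} := by
    ext v
    exact K.starProjection_eq_self_iff.symm
  rw [this]
  exact isClosed_eq K.starProjection.continuous continuous_id

variable (Γ : 𝓱 ≃ₗᵢ⋆[ℂ] 𝓱) (𝔭 𝔮 : Submodule ℂ 𝓱) [𝔭.HasOrthogonalProjection]

/-- The isometric parametrisation `q ↦ (P q, P Γ q)` is inverted by `(a, b) ↦ a + Γ b`. -/
lemma isClosed_betaGraph [𝔮.HasOrthogonalProjection] (h𝔭 : IsBasisProjection Γ 𝔭) :
    IsClosed (betaGraph Γ 𝔭 𝔮 : Set (𝔭 × 𝔭)) := by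
  have h : (betaGraph Γ 𝔭 𝔮 : Set (𝔭 × 𝔭)) = {z | (z.1 : 𝓱) + Γ z.2 ∈ 𝔮 ∧
      𝔭.orthogonalProjectionOnto ((z.1 : 𝓱) + Γ z.2) = z.1 ∧
      𝔭.orthogonalProjectionOnto (Γ ((z.1 : 𝓱) + Γ z.2)) = z.2} := by
    ext z
    constructor
    · rintro ⟨q, hq, rfl⟩
      have hq' : ((𝔭.orthogonalProjectionOnto q : 𝔭) : 𝓱) +
          Γ ((𝔭.orthogonalProjectionOnto (Γ q) : 𝔭) : 𝓱) = q := h𝔭 q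
      change _ ∈ 𝔮 ∧ _ = _ ∧ _ = _
      rw [hq']
      exact ⟨hq, rfl, rfl⟩
    · rintro ⟨h1, h2, h3⟩
      exact ⟨_, h1, by rw [h2, h3]⟩
  rw [h]
  have hc : Continuous fun z : 𝔭 × 𝔭 => (z.1 : 𝓱) + Γ z.2 := by fun_prop
  refine ((isClosed_of_hasOrthogonalProjection 𝔮).preimage hc).inter ((isClosed_eq ?_ ?_).inter
    (isClosed_eq ?_ ?_)) <;> fun_prop

lemma inner_antiunitary_left (hΓ : ∀ f, Γ (Γ f) = f) (v w : 𝓱) :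
    inner ℂ (Γ v) w = (inner ℂ (Γ w) v : ℂ) := by
  rw [← hΓ w, antiunitary_inner_map_map, hΓ]

/-- The polar decomposition of `β`.  The operator `x` is the square root of the compression of `Q`
to `𝔭`, and `j` is determined by `j x y u = P Γ Q u`. -/
theorem exists_isPolarData [CompleteSpace 𝓱] [𝔮.HasOrthogonalProjection] (hΓ : ∀ f, Γ (Γ f) = f)
    (h𝔭 : IsBasisProjection Γ 𝔭) (h𝔮 : ∀ q ∈ 𝔮, Γ q ∈ 𝔮) (hgen : InGenericPosition 𝔭 𝔮) :
    ∃ (x y g : 𝔭 →L[ℂ] 𝔭) (j : 𝔭 ≃ₗᵢ⋆[ℂ] 𝔭), IsPolarData (betaGraph Γ 𝔭 𝔮) x y g j ∧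
      ∀ u : 𝔭, x (x u) = 𝔭.orthogonalProjectionOnto (𝔮.starProjection u) := by
  have : CompleteSpace 𝔭 := (isClosed_of_hasOrthogonalProjection 𝔭).completeSpace_coe
  let b : 𝔭 →L[ℂ] 𝔭 := 𝔭.orthogonalProjectionOnto ∘L 𝔮.starProjection ∘L 𝔭.subtypeL
  have hb : ∀ u, b u = 𝔭.orthogonalProjectionOnto (𝔮.starProjection u) := fun u => rfl
  have hbi : ∀ u v, inner ℂ (b u) v = (inner ℂ (𝔮.starProjection u) (𝔮.starProjection v) : ℂ) := by
    intro u v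
    rw [hb, Submodule.inner_orthogonalProjectionOnto_eq_of_mem_right,
      ← 𝔮.inner_starProjection_left_eq_right]
    congr 1
    exact (𝔮.starProjection_eq_self_iff.2 (𝔮.starProjection_apply_mem _)).symm
  have hbn : ∀ u, (inner ℂ (b u) u : ℂ) = ((‖𝔮.starProjection (u : 𝓱)‖ ^ 2 : ℝ) : ℂ) := by
    intro u
    rw [hbi, inner_self_eq_ofReal]
  have hbs : ∀ u v, inner ℂ (b u) v = (inner ℂ u (b v) : ℂ) := by
    intro u v
    rw [hbi, ← inner_conj_symm, ← hbi, inner_conj_symm]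
  have hb0 : 0 ≤ b := by
    rw [ContinuousLinearMap.nonneg_iff_isPositive, ContinuousLinearMap.isPositive_def]
    refine ⟨hbs, fun u => ?_⟩
    rw [ContinuousLinearMap.reApplyInnerSelf_apply, hbn]
    simp only [RCLike.re_to_complex, Complex.ofReal_re]
    positivity
  have hb1 : 0 ≤ 1 - b := by
    rw [ContinuousLinearMap.nonneg_iff_isPositive, ContinuousLinearMap.isPositive_def]
    refine ⟨fun u v => ?_, fun u => ?_⟩
    · change (inner ℂ (u - b u) v : ℂ) = inner ℂ u (v - b v)
      rw [inner_sub_left, inner_sub_right, hbs]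
    · rw [ContinuousLinearMap.reApplyInnerSelf_apply]
      change 0 ≤ (inner ℂ (u - b u) u : ℂ).re
      rw [inner_sub_left, hbn, inner_self_eq_ofReal, Complex.sub_re, Complex.ofReal_re,
        Complex.ofReal_re]
      have h2 : ‖𝔮.starProjection (u : 𝓱)‖ ≤ ‖u‖ := 𝔮.norm_starProjection_apply_le (u : 𝓱)
      nlinarith [norm_nonneg (𝔮.starProjection (u : 𝓱))]
  have hinj : ∀ u, b u = 0 → u = 0 := by
    intro u hu
    have h1 := hbn u
    rw [hu, inner_zero_left] at h1
    have h2 : 𝔮.starProjection (u : 𝓱) = 0 := by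
      have h3 : ‖𝔮.starProjection (u : 𝓱)‖ ^ 2 = 0 := by exact_mod_cast h1.symm
      simpa using h3
    have h4 : (u : 𝓱) ∈ 𝔭 ⊓ 𝔮ᗮ := ⟨u.2, 𝔮.starProjection_apply_eq_zero_iff.1 h2⟩
    rw [hgen.inf_orthogonal_eq_bot] at h4
    simpa using h4
  have hinj' : ∀ u, u - b u = 0 → u = 0 := by
    intro u hu
    have h1 := hbn u
    rw [← sub_eq_zero.1 hu, inner_self_eq_ofReal] at h1
    have h2 : ‖u‖ ^ 2 = ‖𝔮.starProjection (u : 𝓱)‖ ^ 2 := by exact_mod_cast h1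
    have h3 : (u : 𝓱) ∈ 𝔭 ⊓ 𝔮 := by
      refine ⟨u.2, (𝔮.mem_iff_norm_starProjection _).2 ?_⟩
      exact (pow_left_inj₀ (norm_nonneg _) (norm_nonneg _) two_ne_zero).1 h2.symm
    rw [hgen.inf_eq_bot] at h3
    simpa using h3
  obtain ⟨x, y, g, hpair, hxc, hyc, hgc, hx, hy, hg⟩ := exists_commuting_sqrt b hb0 hb1 hinj
  have hyinj : ∀ u, y u = 0 → u = 0 := fun u hu => hinj' u (by rw [← hy, hu, map_zero])
  -- the antiunitary operator `j`
  let C : 𝔭 →ₗ⋆[ℂ] 𝔭 :=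
    { toFun := fun u => 𝔭.orthogonalProjectionOnto (Γ (𝔮.starProjection u))
      map_add' := fun u v => by simp
      map_smul' := fun c u => by simp [Γ.map_smulₛₗ] }
  have hC : ∀ u, C u = 𝔭.orthogonalProjectionOnto (Γ (𝔮.starProjection u)) := fun u => rfl
  have hnorm : ∀ u, ‖C u‖ = ‖(x * y).toLinearMap u‖ := by
    intro u
    have h1 : ‖C u‖ ^ 2 = ‖𝔮.starProjection (u : 𝓱)‖ ^ 2 - ‖b u‖ ^ 2 := by
      have e1 := 𝔭.norm_sq_eq_add_norm_sq_starProjection (𝔮.starProjection (u : 𝓱))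
      have e2 := h𝔭 (𝔮.starProjection (u : 𝓱))
      have e3 := 𝔭.starProjection_add_starProjection_orthogonal (𝔮.starProjection (u : 𝓱))
      rw [add_left_cancel (e3.trans e2.symm), Γ.norm_map] at e1
      exact eq_sub_of_add_eq' e1.symm
    have h2 : ‖x (y u)‖ ^ 2 = ‖𝔮.starProjection (u : 𝓱)‖ ^ 2 - ‖b u‖ ^ 2 := by
      have e1 : (inner ℂ (x (y u)) (x (y u)) : ℂ) = inner ℂ (b u) u - inner ℂ (b u) (b u) := by
        rw [hpair.symm_left, hx, hpair.symm_right, ← hx, ← hpair.comm, ← hpair.comm, hx, hy,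
          ← hbs, inner_sub_right]
      rw [hbn, inner_self_eq_ofReal, inner_self_eq_ofReal] at e1
      exact_mod_cast e1
    exact (pow_left_inj₀ (norm_nonneg _) (norm_nonneg _) two_ne_zero).1 (h1.trans h2.symm)
  have hxyd : DenseRange (x * y).toLinearMap := by
    refine denseRange_of_symmetric_of_injective (X := x * y) (fun u v => ?_) fun u hu => ?_
    · change (inner ℂ (x (y u)) v : ℂ) = inner ℂ u (x (y v))
      rw [hpair.symm_left, hpair.symm_right, hpair.comm]
    · exact hyinj _ (hpair.injective _ hu)
  have hCd : DenseRange C := by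
    have h : (LinearMap.range C).topologicalClosure = ⊤ := by
      rw [Submodule.topologicalClosure_eq_top_iff, Submodule.eq_bot_iff]
      intro v hv
      have h1 : ∀ u : 𝔭, (inner ℂ (u : 𝓱) (𝔮.starProjection (Γ v)) : ℂ) = 0 := by
        intro u
        have e1 := hv _ ⟨u, rfl⟩
        rw [hC, Submodule.inner_orthogonalProjectionOnto_eq_of_mem_right,
          inner_antiunitary_left Γ hΓ, ← inner_conj_symm,
          𝔮.inner_starProjection_left_eq_right, map_eq_zero] at e1
        exact e1
      have h2 : 𝔮.starProjection (Γ v) ∈ 𝔭ᗮ ⊓ 𝔮 :=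
        ⟨fun u hu => h1 ⟨u, hu⟩, 𝔮.starProjection_apply_mem _⟩
      rw [hgen.orthogonal_inf_eq_bot, Submodule.mem_bot,
        𝔮.starProjection_apply_eq_zero_iff] at h2
      have h3 : (v : 𝓱) ∈ 𝔭 ⊓ 𝔮ᗮ := by
        refine ⟨v.2, fun q hq => ?_⟩
        rw [← hΓ q, inner_antiunitary_left Γ hΓ, ← inner_conj_symm, h2 _ (h𝔮 q hq), map_zero]
      rw [hgen.inf_orthogonal_eq_bot] at h3
      simpa using h3
    intro v
    have : v ∈ (LinearMap.range C).topologicalClosure := h ▸ Submodule.mem_top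
    exact this
  obtain ⟨j, hj⟩ := exists_antiunitary_extension (x * y).toLinearMap C hxyd hCd hnorm
  have hj' : ∀ u, j (x (y u)) = 𝔭.orthogonalProjectionOnto (Γ (𝔮.starProjection u)) := hj
  refine ⟨x, y, g, j, ⟨hpair, hxc, hyc, hgc, hyinj, fun u => by rw [hx, hy, add_sub_cancel], hg,
    fun a c => ⟨?_, fun hac => ?_⟩, ?_⟩, hx⟩
  · -- the relation holds for `q = Q u` with `u ∈ 𝔭`, and these `q` are dense in `𝔮`
    rintro ⟨q, hq, hqac⟩
    obtain ⟨rfl, rfl⟩ := Prod.ext_iff.1 hqac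
    let V : Submodule ℂ 𝓱 := (𝔭.map 𝔮.starProjection.toLinearMap).topologicalClosure
    have : CompleteSpace V := (Submodule.isClosed_topologicalClosure _).completeSpace_coe
    have hV𝔮 : V ≤ 𝔮 := by
      refine Submodule.topologicalClosure_minimal _ ?_ (isClosed_of_hasOrthogonalProjection 𝔮)
      rintro _ ⟨u, -, rfl⟩
      exact 𝔮.starProjection_apply_mem _
    have hqV : q ∈ V := by
      obtain ⟨v, hv, w, hw, rfl⟩ := V.exists_add_mem_mem_orthogonal q
      have hw𝔮 : w ∈ 𝔮 := by
        have := sub_mem hq (hV𝔮 hv)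
        rwa [add_sub_cancel_left] at this
      have h1 : w ∈ 𝔭ᗮ ⊓ 𝔮 := by
        refine ⟨fun u hu => ?_, hw𝔮⟩
        have h2 := hw _ (Submodule.le_topologicalClosure _ ⟨u, hu, rfl⟩)
        change (inner ℂ (𝔮.starProjection u) w : ℂ) = 0 at h2
        rwa [𝔮.inner_starProjection_left_eq_right, 𝔮.starProjection_eq_self_iff.2 hw𝔮] at h2
      rw [hgen.orthogonal_inf_eq_bot, Submodule.mem_bot] at h1
      rwa [h1, add_zero]
    have hcl : IsClosed {q : 𝓱 | y (𝔭.orthogonalProjectionOnto q) =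
        x (j.symm (𝔭.orthogonalProjectionOnto (Γ q)))} := isClosed_eq (by fun_prop) (by fun_prop)
    refine closure_minimal (s := (𝔭.map 𝔮.starProjection.toLinearMap : Set 𝓱)) ?_ hcl hqV
    rintro _ ⟨u, hu, rfl⟩
    change y (b ⟨u, hu⟩) = x (j.symm (C ⟨u, hu⟩))
    rw [hC, ← hj', j.symm_apply_apply, ← hx, hpair.comm, hpair.comm]
  · have h1 := hpair.mem_closure_image hac hpair.denseRange
    have h2 : ((fun z : 𝔭 × 𝔭 => (z.1, j z.2)) (a, j.symm c)) ∈ betaGraph Γ 𝔭 𝔮 := by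
      refine closure_minimal (s := (fun u => (x u, y u)) '' Set.range x) ?_
        ((isClosed_betaGraph Γ 𝔭 𝔮 h𝔭).preimage
          (f := fun z : 𝔭 × 𝔭 => (z.1, j z.2)) (by fun_prop)) h1
      rintro _ ⟨_, ⟨u, rfl⟩, rfl⟩
      refine ⟨𝔮.starProjection u, 𝔮.starProjection_apply_mem _, ?_⟩
      change (x (x u), j (y (x u))) = _
      rw [← hj', ← hb, hx, hpair.comm]
    simpa using h2
  · rintro a c ⟨q, hq, hqac⟩
    exact ⟨Γ q, h𝔮 q hq, by rw [hΓ]; exact congrArg Prod.swap hqac⟩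

end OneParticle

/-! ### The modular structure of the vacuum -/

noncomputable section Tomita

variable {E : Type*} [NormedAddCommGroup E] [InnerProductSpace ℂ E]

lemma IsSymmContraction.mul_self {A : E →L[ℂ] E} (hA : IsSymmContraction A) :
    IsSymmContraction (A * A) where
  symm u v := by
    change (inner ℂ (A (A u)) v : ℂ) = inner ℂ u (A (A v))
    rw [hA.symm, hA.symm]
  norm_le u := (hA.norm_le (A u)).trans (hA.norm_le u)

lemma secondQuant_mul_self {A : E →L[ℂ] E} (hA : IsSymmContraction A) :
    secondQuant hA * secondQuant hA = secondQuant hA.mul_self :=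
  ContinuousLinearMap.ext fun v => secondQuant_comp hA hA hA.mul_self (fun _ => rfl) v

/-- The linear span of all products `p₁ ∧ … ∧ pₙ`. -/
def wedgeSpan (E : Type*) [NormedAddCommGroup E] [InnerProductSpace ℂ E] :
    Submodule ℂ (FockSpace E) :=
  Submodule.span ℂ {ψ | ∃ (n : ℕ) (p : Fin n → E), ψ = wedge n p}

lemma dense_wedgeSpan : Dense (wedgeSpan E : Set (FockSpace E)) := by
  rw [Submodule.dense_iff_topologicalClosure_eq_top,
    ← span_wedge_topologicalClosure (E := E) dense_univ]
  simp [wedgeSpan]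

namespace IsPolarData

variable {R : SetRel E E} {x y g : E →L[ℂ] E} {j : E ≃ₗᵢ⋆[ℂ] E}

lemma comm (h : IsPolarData R x y g j) (u : E) : x (y u) = y (x u) := h.pair.comm u

lemma mem_left (h : IsPolarData R x y g j) (u : E) : (x u, j (y u)) ∈ R := by
  rw [h.mem_iff, j.symm_apply_apply, h.comm]

variable [CompleteSpace E]

lemma isPolarDecomposition (h : IsPolarData R x y g j) :
    IsPolarDecomposition R j (pairOperator x y) where
  positive := h.pair.isPositiveSelfAdjoint fun u => by
    rw [h.contr_left.symm, ← h.sqrt_mul_sqrt, ← h.contr_sqrt.symm]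
    exact inner_self_nonneg (𝕜 := ℂ)
  graph_eq := by
    ext ⟨a, b⟩
    rw [h.mem_iff, ← h.pair.mem_graph, LinearPMap.mem_graph_iff]
    constructor
    · rintro ⟨u, hu, hu'⟩
      refine ⟨u, Prod.ext hu ?_⟩
      change j _ = b
      rw [hu']
      exact j.apply_symm_apply b
    · rintro ⟨u, hu⟩
      obtain ⟨rfl, rfl⟩ := Prod.ext_iff.1 hu
      exact ⟨u, rfl, (j.symm_apply_apply _).symm⟩

lemma mem_adjoint (h : IsPolarData R x y g j) (u : E) :
    (j (x u), y u) ∈ antilinearAdjoint R := by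
  rw [h.isPolarDecomposition.mem_adjoint_iff, j.symm_apply_apply, h.pair.mem_graph, h.comm]

/-- The second quantization of polar data. -/
lemma fock_pair (h : IsPolarData R x y g j) :
    IsCommutingPair (secondQuant h.contr_left) (secondQuant h.contr_right) where
  symm_left := inner_secondQuant _
  symm_right := inner_secondQuant _
  comm v := by
    have hc : ∀ u, x (y u) = (g * g) u := fun u => (h.sqrt_mul_sqrt u).symm
    rw [secondQuant_comp _ _ h.contr_sqrt.mul_self hc,
      secondQuant_comp _ _ h.contr_sqrt.mul_self fun u => by rw [← h.comm, hc]]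
  injective := secondQuant_injective _ h.pair.denseRange

lemma fock_injective_right (h : IsPolarData R x y g j) (v : FockSpace E)
    (hv : secondQuant h.contr_right v = 0) : v = 0 :=
  secondQuant_injective _
    (denseRange_of_symmetric_of_injective h.contr_right.symm h.injective_right) v hv

variable {J : FockSpace E ≃ₗᵢ⋆[ℂ] FockSpace E}

/-- The vectors `Γ(x)² u`, with `u` in the algebraic Fock space, are generated from the vacuum by
the von Neumann algebra, and its Tomita operator acts on them as `J Γ(x)⁻¹ Γ(y)`. -/
lemma exists_mem_algebra (h : IsPolarData R x y g j)
    (hJ : ∀ n (p : Fin n → E), J (wedge n p) = wedge n fun i => j (p i.rev)) {u : FockSpace E}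
    (hu : u ∈ wedgeSpan E) : ∃ A ∈ Set.centralizer (Set.centralizer (fieldSet R)),
      A (vacuum E) = secondQuant h.contr_left (secondQuant h.contr_left u) ∧
      ContinuousLinearMap.adjoint A (vacuum E) =
        J (secondQuant h.contr_right (secondQuant h.contr_left u)) := by
  let 𝔞 := Subalgebra.centralizer ℂ (Set.centralizer (fieldSet R))
  change ∃ A ∈ 𝔞, _
  induction hu using Submodule.span_induction with
  | mem u hu =>
    obtain ⟨n, p, rfl⟩ := hu
    obtain ⟨A, hA, hA1, hA2⟩ := exists_wick_left h.symm n (fun i => x (x (p i)))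
      (fun i => j (y (x (p i)))) (fun i => y (y (p i))) (fun i => h.mem_left _)
      (fun i => by rw [← h.comm]; exact h.mem_adjoint _)
    refine ⟨A, hA, ?_, ?_⟩
    · rw [hA1, secondQuant_wedge, secondQuant_wedge]
    · rw [hA2, secondQuant_wedge, secondQuant_wedge, hJ]
  | zero => exact ⟨0, zero_mem _, by simp, by simp⟩
  | add u v _ _ hu hv =>
    obtain ⟨A, hA, hA1, hA2⟩ := hu
    obtain ⟨B, hB, hB1, hB2⟩ := hv
    exact ⟨A + B, add_mem hA hB, by simp [hA1, hB1], by simp [hA2, hB2]⟩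
  | smul c u _ hu =>
    obtain ⟨A, hA, hA1, hA2⟩ := hu
    exact ⟨c • A, Subalgebra.smul_mem _ hA c, by simp [hA1],
      by simp [map_smulₛₗ, hA2]⟩

/-- The corresponding statement for the commutant and the adjoint of `J Γ(x)⁻¹ Γ(y)`. -/
lemma exists_mem_commutant (h : IsPolarData R x y g j)
    (hJ : ∀ n (p : Fin n → E), J (wedge n p) = wedge n fun i => j (p i.rev)) (n : ℕ)
    (p : Fin n → E) : ∃ A ∈ Set.centralizer (fieldSet R),
      A (vacuum E) = J (secondQuant h.contr_left (secondQuant h.contr_left (wedge n p))) ∧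
      ContinuousLinearMap.adjoint A (vacuum E) =
        secondQuant h.contr_right (secondQuant h.contr_left (wedge n p)) := by
  obtain ⟨A, hA, hA1, hA2⟩ := exists_wick_right h.symm n (fun i => j (x (x (p i))))
    (fun i => y (x (p i))) (fun i => j (y (y (p i)))) (fun i => h.mem_adjoint _)
    (fun i => by rw [← h.comm]; exact h.mem_left _)
  refine ⟨A, hA, ?_, ?_⟩
  · rw [hA1, secondQuant_wedge, secondQuant_wedge, hJ]
  · rw [hA2, secondQuant_wedge, secondQuant_wedge]

lemma isCyclicVector (h : IsPolarData R x y g j) :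
    IsCyclicVector (Set.centralizer (Set.centralizer (fieldSet R))) (vacuum E) := by
  obtain ⟨J, hJ⟩ := exists_antiunitary_wedge j
  have hd := (h.fock_pair.sq.denseRange).dense_image (by fun_prop) dense_wedgeSpan
  refine hd.mono ?_
  rintro _ ⟨u, hu, rfl⟩
  obtain ⟨A, hA, hA1, -⟩ := h.exists_mem_algebra hJ hu
  exact ⟨A, hA, hA1.symm⟩

lemma isSeparatingVector (h : IsPolarData R x y g j) :
    IsSeparatingVector (Set.centralizer (Set.centralizer (fieldSet R))) (vacuum E) := by
  obtain ⟨J, hJ⟩ := exists_antiunitary_wedge j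
  intro A hA hA0
  have h1 : ∀ u ∈ wedgeSpan E,
      A (J (secondQuant h.contr_left (secondQuant h.contr_left u))) = 0 := by
    intro u hu
    induction hu using Submodule.span_induction with
    | mem u hu =>
      obtain ⟨n, p, rfl⟩ := hu
      obtain ⟨B, hB, hB1, -⟩ := h.exists_mem_commutant hJ n p
      rw [← hB1]
      have h2 := DFunLike.congr_fun (hA B hB) (vacuum E)
      change B (A (vacuum E)) = A (B (vacuum E)) at h2
      rw [← h2, hA0, map_zero]
    | zero => simp
    | add u v _ _ hu hv => simp only [map_add, hu, hv, add_zero]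
    | smul c u _ hu => simp only [map_smul, map_smulₛₗ, hu, smul_zero]
  have hd : Dense ((fun u => J (secondQuant h.contr_left (secondQuant h.contr_left u))) ''
      (wedgeSpan E : Set (FockSpace E))) := by
    refine DenseRange.dense_image ?_ (by fun_prop) dense_wedgeSpan
    exact J.surjective.denseRange.comp h.fock_pair.sq.denseRange J.continuous
  ext v
  refine hd.induction (P := fun v => A v = 0) ?_ (isClosed_eq A.continuous continuous_const) v
  rintro _ ⟨u, hu, rfl⟩
  exact h1 u hu

/-- The Tomita operator is `J Γ(x)⁻¹ Γ(y)`.  It extends `J Γ(x)⁻¹ Γ(y)` because the vectors of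
`exists_mem_algebra` form a core of the latter, and it is a restriction because every `A` in the
algebra satisfies `⟪A* Ω, A' Ω⟫ = ⟪A'* Ω, A Ω⟫` for the operators `A'` of
`exists_mem_commutant`. -/
theorem mem_tomitaGraph_iff (h : IsPolarData R x y g j)
    (hJ : ∀ n (p : Fin n → E), J (wedge n p) = wedge n fun i => j (p i.rev)) {a b : FockSpace E} :
    (a, b) ∈ tomitaGraph (Set.centralizer (Set.centralizer (fieldSet R))) (vacuum E) ↔
      secondQuant h.contr_right a = secondQuant h.contr_left (J.symm b) := by
  set X := secondQuant h.contr_left with hX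
  set Y := secondQuant h.contr_right with hY
  constructor
  · intro hab
    refine closure_minimal (t := {z : FockSpace E × FockSpace E | Y z.1 = X (J.symm z.2)}) ?_
      (isClosed_eq (by fun_prop) (by fun_prop)) hab
    rintro _ ⟨A, hA, rfl⟩
    change Y (A (vacuum E)) = X (J.symm (ContinuousLinearMap.adjoint A (vacuum E)))
    rw [← sub_eq_zero]
    refine h.fock_pair.injective _ (dense_wedgeSpan.eq_zero_of_inner_right ℂ fun u hu => ?_)
    induction hu using Submodule.span_induction with
    | mem u hu =>
      obtain ⟨n, p, rfl⟩ := hu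
      obtain ⟨B, hB, hB1, hB2⟩ := h.exists_mem_commutant hJ n p
      have h1 : (inner ℂ (ContinuousLinearMap.adjoint A (vacuum E)) (B (vacuum E)) : ℂ) =
          inner ℂ (ContinuousLinearMap.adjoint B (vacuum E)) (A (vacuum E)) := by
        rw [ContinuousLinearMap.adjoint_inner_left, ContinuousLinearMap.adjoint_inner_left]
        have h2 := DFunLike.congr_fun (hA B hB) (vacuum E)
        exact congrArg _ h2.symm
      rw [hB1, hB2, ← inner_conj_symm, ← antiunitary_inner_symm_left, inner_conj_symm] at h1
      rw [← inner_secondQuant, inner_sub_right, ← inner_secondQuant, ← inner_secondQuant, h1,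
        sub_self]
    | zero => simp
    | add u v _ _ hu hv => rw [inner_add_left, hu, hv, add_zero]
    | smul c u _ hu => rw [inner_smul_left, hu, mul_zero]
  · intro hab
    have hD : Dense (X '' (wedgeSpan E : Set (FockSpace E))) :=
      h.fock_pair.denseRange.dense_image X.continuous dense_wedgeSpan
    have h1 := h.fock_pair.mem_closure_image hab hD
    have h2 := closure_minimal (t := (fun z : FockSpace E × FockSpace E => (z.1, J z.2)) ⁻¹'
      tomitaGraph (Set.centralizer (Set.centralizer (fieldSet R))) (vacuum E)) (by
        rintro _ ⟨_, ⟨u, hu, rfl⟩, rfl⟩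
        obtain ⟨A, hA, hA1, hA2⟩ := h.exists_mem_algebra hJ hu
        exact subset_closure ⟨A, hA, by rw [hA1, hA2]⟩)
      (isClosed_closure.preimage (by fun_prop)) h1
    simpa using h2

lemma fock_isPositiveSelfAdjoint (h : IsPolarData R x y g j) :
    IsPositiveSelfAdjoint (pairOperator (secondQuant h.contr_left) (secondQuant h.contr_right)) :=
  h.fock_pair.isPositiveSelfAdjoint fun u => by
    have hc : ∀ v, secondQuant h.contr_left (secondQuant h.contr_right v) =
        secondQuant h.contr_sqrt (secondQuant h.contr_sqrt v) := fun v => by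
      rw [secondQuant_comp _ _ h.contr_sqrt.mul_self fun u => (h.sqrt_mul_sqrt u).symm,
        secondQuant_comp _ _ h.contr_sqrt.mul_self fun u => rfl]
    rw [inner_secondQuant, hc, ← inner_secondQuant]
    exact inner_self_nonneg (𝕜 := ℂ)

/-- The modular operator is positive: `⟪X² u, Y² u⟫ = ‖X Y u‖²`. -/
lemma fock_sq_isPositiveSelfAdjoint (h : IsPolarData R x y g j) :
    IsPositiveSelfAdjoint (pairOperator (secondQuant h.contr_left * secondQuant h.contr_left)
      (secondQuant h.contr_right * secondQuant h.contr_right)) :=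
  h.fock_pair.sq.isPositiveSelfAdjoint fun u => by
    have hc := h.fock_pair.comm
    change 0 ≤ (inner ℂ (secondQuant h.contr_left (secondQuant h.contr_left u))
      (secondQuant h.contr_right (secondQuant h.contr_right u)) : ℂ).re
    rw [← inner_secondQuant, ← hc, inner_secondQuant, hc, ← hc]
    exact inner_self_nonneg (𝕜 := ℂ)

theorem fock_isPolarDecomposition (h : IsPolarData R x y g j)
    (hJ : ∀ n (p : Fin n → E), J (wedge n p) = wedge n fun i => j (p i.rev)) :
    IsPolarDecomposition (tomitaGraph (Set.centralizer (Set.centralizer (fieldSet R))) (vacuum E)) J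
      (pairOperator (secondQuant h.contr_left) (secondQuant h.contr_right)) where
  positive := h.fock_isPositiveSelfAdjoint
  graph_eq := by
    ext ⟨a, b⟩
    rw [h.mem_tomitaGraph_iff hJ, ← h.fock_pair.mem_graph, LinearPMap.mem_graph_iff]
    constructor
    · rintro ⟨u, hu, hu'⟩
      refine ⟨u, Prod.ext hu ?_⟩
      change J _ = b
      rw [hu']
      exact J.apply_symm_apply b
    · rintro ⟨u, hu⟩
      obtain ⟨rfl, rfl⟩ := Prod.ext_iff.1 hu
      exact ⟨u, rfl, (J.symm_apply_apply _).symm⟩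

lemma dense_range_fock (h : IsPolarData R x y g j) : Dense {d | ∃ c, (c, d) ∈
    (pairOperator (secondQuant h.contr_left) (secondQuant h.contr_right)).graph} := by
  refine (denseRange_of_symmetric_of_injective (inner_secondQuant h.contr_right)
    h.fock_injective_right).mono ?_
  rintro _ ⟨u, rfl⟩
  exact ⟨secondQuant h.contr_left u, h.fock_pair.mem_graph.2 (h.fock_pair.comm u).symm⟩

lemma mem_graph_modular (h : IsPolarData R x y g j) {c d : FockSpace E} :
    (c, d) ∈ (pairOperator (secondQuant h.contr_left * secondQuant h.contr_left)
      (secondQuant h.contr_right * secondQuant h.contr_right)).graph ↔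
    secondQuant h.contr_right.mul_self c = secondQuant h.contr_left.mul_self d := by
  rw [h.fock_pair.sq.mem_graph, secondQuant_mul_self, secondQuant_mul_self]

lemma starProjection_mem_graph (h : IsPolarData R x y g j) (n : ℕ) {c d : FockSpace E}
    (hcd : (c, d) ∈ (pairOperator (secondQuant h.contr_left * secondQuant h.contr_left)
      (secondQuant h.contr_right * secondQuant h.contr_right)).graph) :
    ((nParticle E n).starProjection c, (nParticle E n).starProjection d) ∈
      (pairOperator (secondQuant h.contr_left * secondQuant h.contr_left)
      (secondQuant h.contr_right * secondQuant h.contr_right)).graph := by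
  rw [h.mem_graph_modular] at hcd ⊢
  rw [secondQuant_starProjection, secondQuant_starProjection, hcd]

lemma wedge_mem_graph (h : IsPolarData R x y g j) (n : ℕ)
    (p : Fin n → (pairOperator (x * x) (y * y)).domain) :
    (wedge n (fun i => (p i : E)), wedge n (fun i => pairOperator (x * x) (y * y) (p i))) ∈
      (pairOperator (secondQuant h.contr_left * secondQuant h.contr_left)
      (secondQuant h.contr_right * secondQuant h.contr_right)).graph := by
  rw [h.mem_graph_modular, secondQuant_wedge, secondQuant_wedge]
  congr 1
  ext i
  exact h.pair.sq.mem_graph.1 ((pairOperator (x * x) (y * y)).mem_graph (p i))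

lemma mem_graph_one_iff (h : IsPolarData R x y g j) {ψ : FockSpace E} (hψ : ψ ∈ nParticle E 1)
    (φ : FockSpace E) : (ψ, φ) ∈ (pairOperator (secondQuant h.contr_left * secondQuant h.contr_left)
      (secondQuant h.contr_right * secondQuant h.contr_right)).graph ↔
    ∃ p : (pairOperator (x * x) (y * y)).domain,
      ψ = oneParticle (p : E) ∧ φ = oneParticle (pairOperator (x * x) (y * y) p) := by
  constructor
  · intro hg
    have h1 := h.starProjection_mem_graph 1 hg
    rw [(nParticle E 1).starProjection_eq_self_iff.2 hψ] at h1
    have h2 := LinearPMap.mem_graph_snd_inj _ hg h1 rfl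
    obtain ⟨p, rfl⟩ := mem_nParticle_one.1 hψ
    obtain ⟨q, hq⟩ := mem_nParticle_one.1 ((nParticle E 1).starProjection_apply_mem φ)
    rw [hq] at h2
    subst h2
    rw [h.mem_graph_modular, secondQuant_oneParticle, secondQuant_oneParticle] at hg
    obtain ⟨u, hu, hu'⟩ := (LinearPMap.mem_graph_iff _).1
      (h.pair.sq.mem_graph.2 (oneParticle_injective hg))
    exact ⟨u, by rw [hu], by rw [hu']⟩
  · rintro ⟨p, rfl, rfl⟩
    rw [h.mem_graph_modular, secondQuant_oneParticle, secondQuant_oneParticle,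
      h.pair.sq.mem_graph.1 ((pairOperator (x * x) (y * y)).mem_graph p)]

/-- The algebraic exterior power of the domain of the one-particle modular operator is a core on
each particle number subspace: it contains `Γ(x²) u` for all algebraic `n`-particle vectors `u`. -/
theorem hasCore (h : IsPolarData R x y g j) (n : ℕ) :
    ((pairOperator (secondQuant h.contr_left * secondQuant h.contr_left)
      (secondQuant h.contr_right * secondQuant h.contr_right)).domRestrict
        (nParticle E n)).HasCore (algWedgePower n (pairOperator (x * x) (y * y)).domain) := by
  set Δ := pairOperator (secondQuant h.contr_left * secondQuant h.contr_left)
      (secondQuant h.contr_right * secondQuant h.contr_right) with hΔ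
  set D := algWedgePower n (pairOperator (x * x) (y * y)).domain with hDdef
  have hmemr : ∀ {S : Submodule ℂ (FockSpace E)} {T : FockSpace E →ₗ.[ℂ] FockSpace E}
      {c d : FockSpace E}, (c, d) ∈ (T.domRestrict S).graph ↔ c ∈ S ∧ (c, d) ∈ T.graph := by
    intro S T c d
    rw [LinearPMap.mem_graph_iff, LinearPMap.mem_graph_iff]
    constructor
    · rintro ⟨⟨u, hu1, hu2⟩, rfl, rfl⟩
      exact ⟨hu1, ⟨u, hu2⟩, rfl, rfl⟩
    · rintro ⟨hc, ⟨u, hu⟩, rfl, rfl⟩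
      exact ⟨⟨u, hc, hu⟩, rfl, rfl⟩
  have hDle : D ≤ nParticle E n ⊓ Δ.domain := by
    refine Submodule.span_le.2 ?_
    rintro _ ⟨p, hp, rfl⟩
    refine ⟨wedge_mem_nParticle n p, ?_⟩
    have := h.wedge_mem_graph n fun i => ⟨p i, hp i⟩
    exact LinearPMap.mem_domain_of_mem_graph this
  have hcl : (Δ.domRestrict (nParticle E n)).IsClosed := by
    have : ((Δ.domRestrict (nParticle E n)).graph : Set (FockSpace E × FockSpace E)) =
        (Prod.fst ⁻¹' (nParticle E n : Set (FockSpace E))) ∩ Δ.graph := by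
      ext ⟨c, d⟩
      exact hmemr
    rw [LinearPMap.IsClosed, this]
    refine ((Submodule.isClosed_topologicalClosure _).preimage continuous_fst).inter ?_
    exact h.fock_sq_isPositiveSelfAdjoint.isClosed_graph
  have hle : (Δ.domRestrict (nParticle E n)).domRestrict D ≤ Δ.domRestrict (nParticle E n) :=
    LinearPMap.le_of_le_graph fun ⟨c, d⟩ hz => (hmemr.1 hz).2
  have hclb : ((Δ.domRestrict (nParticle E n)).domRestrict D).IsClosable :=
    hcl.isClosable.leIsClosable hle
  refine ⟨hDle, LinearPMap.eq_of_eq_graph ?_⟩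
  rw [← hclb.graph_closure_eq_closure_graph]
  refine le_antisymm (Submodule.topologicalClosure_minimal _ (LinearPMap.le_graph_of_le hle) hcl) ?_
  rintro ⟨c, d⟩ hcd
  obtain ⟨hc, hcd⟩ := hmemr.1 hcd
  set K := ((Δ.domRestrict (nParticle E n)).domRestrict D).graph.topologicalClosure with hK
  let L : FockSpace E →L[ℂ] FockSpace E × FockSpace E :=
    (secondQuant h.contr_left.mul_self).prod (secondQuant h.contr_right.mul_self)
  have hL : nParticle E n ≤ K.comap L.toLinearMap := by
    refine Submodule.topologicalClosure_minimal _ (Submodule.span_le.2 ?_)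
      ((Submodule.isClosed_topologicalClosure _).preimage L.continuous)
    rintro _ ⟨p, rfl⟩
    refine Submodule.le_topologicalClosure _ ?_
    have hp : ∀ i, ((x * x) (p i), (y * y) (p i)) ∈ (pairOperator (x * x) (y * y)).graph := fun i =>
      h.pair.sq.mem_graph.2 (h.pair.sq.comm _).symm
    change (secondQuant h.contr_left.mul_self (wedge n p),
      secondQuant h.contr_right.mul_self (wedge n p)) ∈ _
    rw [secondQuant_wedge, secondQuant_wedge, hmemr, hmemr, h.mem_graph_modular]
    refine ⟨Submodule.subset_span ⟨_, fun i => LinearPMap.mem_domain_of_mem_graph (hp i), rfl⟩,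
      wedge_mem_nParticle _ _, ?_⟩
    rw [secondQuant_wedge, secondQuant_wedge]
    congr 1
    ext i
    exact (h.pair.sq.comm _).symm
  have hd : (nParticle E n).starProjection d = d := by
    have h1 := h.starProjection_mem_graph n hcd
    rw [(nParticle E n).starProjection_eq_self_iff.2 hc] at h1
    exact LinearPMap.mem_graph_snd_inj _ h1 hcd rfl
  have h1 := h.fock_pair.sq.mem_closure_range (h.fock_pair.sq.mem_graph.1 hcd)
  have h2 := closure_minimal (t := {z : FockSpace E × FockSpace E |
      ((nParticle E n).starProjection z.1, (nParticle E n).starProjection z.2) ∈ K}) (by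
      rintro _ ⟨u, rfl⟩
      have := hL ((nParticle E n).starProjection_apply_mem u)
      change (secondQuant h.contr_left.mul_self _, secondQuant h.contr_right.mul_self _) ∈ K at this
      rw [secondQuant_starProjection, secondQuant_starProjection] at this
      change (_, _) ∈ K
      rwa [secondQuant_mul_self, secondQuant_mul_self])
    ((Submodule.isClosed_topologicalClosure _).preimage
      (f := fun z : FockSpace E × FockSpace E =>
        ((nParticle E n).starProjection z.1, (nParticle E n).starProjection z.2))
      (by fun_prop)) h1
  change (_, _) ∈ K at h2
  rwa [hd, (nParticle E n).starProjection_eq_self_iff.2 hc] at h2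

end IsPolarData

end Tomita

/-! ### The modular objects of the algebra of field operators -/

/-- Since `𝔮` is `Γ`-invariant, the generators `a(q)` are the field operators of the relation
`β`. -/
lemma image_fieldOperator_eq {𝓱 : Type*} [NormedAddCommGroup 𝓱] [InnerProductSpace ℂ 𝓱]
    (Γ : 𝓱 ≃ₗᵢ⋆[ℂ] 𝓱) (hΓ : ∀ f, Γ (Γ f) = f) (𝔭 𝔮 : Submodule ℂ 𝓱)
    [𝔭.HasOrthogonalProjection] (h𝔮 : ∀ q ∈ 𝔮, Γ q ∈ 𝔮) :
    fieldOperator Γ 𝔭 '' (𝔮 : Set 𝓱) = fieldSet (betaGraph Γ 𝔭 𝔮) := by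
  ext L
  constructor
  · rintro ⟨q, hq, rfl⟩
    refine ⟨_, ⟨Γ q, h𝔮 q hq, rfl⟩, ?_⟩
    rw [hΓ]
    rfl
  · rintro ⟨_, ⟨q, hq, rfl⟩, rfl⟩
    refine ⟨Γ q, h𝔮 q hq, ?_⟩
    rw [fieldOperator, hΓ]
    rfl

theorem mainTheorem2 {𝓱 : Type*} [NormedAddCommGroup 𝓱] [InnerProductSpace ℂ 𝓱] [CompleteSpace 𝓱]
    (Γ : 𝓱 ≃ₗᵢ⋆[ℂ] 𝓱) (hΓ : ∀ f, Γ (Γ f) = f)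
    (𝔭 𝔮 : Submodule ℂ 𝓱) [𝔭.HasOrthogonalProjection] [𝔮.HasOrthogonalProjection]
    (h𝔭 : IsBasisProjection Γ 𝔭) (h𝔮 : ∀ q ∈ 𝔮, Γ q ∈ 𝔮) (hgen : InGenericPosition 𝔭 𝔮) :
    -- the vacuum is cyclic and separating, so that the Tomita operator `S` is defined
    IsCyclicVector (carVonNeumannAlgebra Γ 𝔭 𝔮) (vacuum 𝔭) ∧
    IsSeparatingVector (carVonNeumannAlgebra Γ 𝔭 𝔮) (vacuum 𝔭) ∧
    ∃ (Δ Δhalf : FockSpace 𝔭 →ₗ.[ℂ] FockSpace 𝔭) (J : FockSpace 𝔭 ≃ₗᵢ⋆[ℂ] FockSpace 𝔭)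
      (Δ𝔭 : 𝔭 →ₗ.[ℂ] 𝔭) (j : 𝔭 ≃ₗᵢ⋆[ℂ] 𝔭),
      -- `Δ = S* S` is positive self-adjoint with square root `Δhalf`, and `S = J Δhalf` is the
      -- unique polar decomposition of `S`
      (Δ.graph : SetRel (FockSpace 𝔭) (FockSpace 𝔭)) =
        (tomitaGraph (carVonNeumannAlgebra Γ 𝔭 𝔮) (vacuum 𝔭)).comp
          (antilinearAdjoint (tomitaGraph (carVonNeumannAlgebra Γ 𝔭 𝔮) (vacuum 𝔭))) ∧
      IsPositiveSelfAdjoint Δ ∧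
      IsPolarDecomposition (tomitaGraph (carVonNeumannAlgebra Γ 𝔭 𝔮) (vacuum 𝔭)) J Δhalf ∧
      (∀ J' T', IsPolarDecomposition (tomitaGraph (carVonNeumannAlgebra Γ 𝔭 𝔮) (vacuum 𝔭)) J' T' →
        J' = J ∧ T' = Δhalf) ∧
      (Δ.graph : SetRel (FockSpace 𝔭) (FockSpace 𝔭)) =
        SetRel.comp (Δhalf.graph : SetRel (FockSpace 𝔭) (FockSpace 𝔭)) Δhalf.graph ∧
      -- `Δ𝔭 = β* β`, with domain `P Q 𝔭`
      (Δ𝔭.graph : SetRel 𝔭 𝔭) = (betaGraph Γ 𝔭 𝔮).comp (antilinearAdjoint (betaGraph Γ 𝔭 𝔮)) ∧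
      (Δ𝔭.domain : Set 𝔭) =
        {x | ∃ p ∈ 𝔭, x = 𝔭.orthogonalProjectionOnto (𝔮.starProjection p)} ∧
      -- `Δ` and `J` can be restricted to the `n`-particle subspaces
      (∀ n ψ φ, (ψ, φ) ∈ Δ.graph →
        ((nParticle 𝔭 n).starProjection ψ, (nParticle 𝔭 n).starProjection φ) ∈ Δ.graph) ∧
      (∀ n ψ, J ((nParticle 𝔭 n).starProjection ψ) = (nParticle 𝔭 n).starProjection (J ψ)) ∧
      -- the restriction of `Δ` to the one-particle subspace is `Δ𝔭`
      (∀ ψ ∈ nParticle 𝔭 1, ∀ φ, (ψ, φ) ∈ Δ.graph ↔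
        ∃ p : Δ𝔭.domain, ψ = oneParticle (p : 𝔭) ∧ φ = oneParticle (Δ𝔭 p)) ∧
      -- the action of `Δ` on `n`-particle vectors
      (∀ n (p : Fin n → Δ𝔭.domain),
        (wedge n (fun i => (p i : 𝔭)), wedge n (fun i => Δ𝔭 (p i))) ∈ Δ.graph) ∧
      -- the domain of the restriction of `Δ` to the `n`-particle subspace is the closure of the
      -- algebraic exterior power of the domain of `Δ𝔭` in the graph norm
      (∀ n, (Δ.domRestrict (nParticle 𝔭 n)).HasCore (algWedgePower n Δ𝔭.domain)) ∧
      -- the action of `J` on `n`-particle vectors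
      (∀ p : 𝔭, J (oneParticle p) = oneParticle (j p)) ∧
      (∀ n (p : Fin n → 𝔭), J (wedge n p) = wedge n (fun i => j (p i.rev))) := by
  obtain ⟨x, y, g, j, h, hx⟩ := exists_isPolarData Γ 𝔭 𝔮 hΓ h𝔭 h𝔮 hgen
  have : CompleteSpace 𝔭 := (isClosed_of_hasOrthogonalProjection 𝔭).completeSpace_coe
  obtain ⟨J, hJ⟩ := exists_antiunitary_wedge j
  have hpol := h.fock_isPolarDecomposition hJ
  have hM : carVonNeumannAlgebra Γ 𝔭 𝔮 =
      Set.centralizer (Set.centralizer (fieldSet (betaGraph Γ 𝔭 𝔮))) := by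
    rw [carVonNeumannAlgebra, image_fieldOperator_eq Γ hΓ 𝔭 𝔮 h𝔮]
  rw [hM]
  refine ⟨h.isCyclicVector, h.isSeparatingVector,
    pairOperator (secondQuant h.contr_left * secondQuant h.contr_left)
      (secondQuant h.contr_right * secondQuant h.contr_right),
    pairOperator (secondQuant h.contr_left) (secondQuant h.contr_right), J,
    pairOperator (x * x) (y * y), j, ?_, h.fock_sq_isPositiveSelfAdjoint, hpol,
    fun J' T' h' => hpol.unique h' h.dense_range_fock, h.fock_pair.graph_sq, ?_, ?_,
    fun n ψ φ hg => h.starProjection_mem_graph n hg,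
    fun n ψ => antiunitary_starProjection hJ n ψ,
    fun ψ hψ φ => h.mem_graph_one_iff hψ φ, h.wedge_mem_graph, h.hasCore, fun p => ?_, hJ⟩
  · rw [hpol.comp_adjoint]
    exact h.fock_pair.graph_sq
  · rw [h.isPolarDecomposition.comp_adjoint]
    exact h.pair.graph_sq
  · -- `y² c = x² d` means `c = x² (c + d)`, because `x² + y² = 1`
    ext c
    rw [SetLike.mem_coe, LinearPMap.mem_domain_iff]
    constructor
    · rintro ⟨d, hd⟩
      refine ⟨_, (c + d).2, ?_⟩
      have h1 : y (y c) = x (x d) := h.pair.sq.mem_graph.1 hd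
      rw [← hx, map_add, map_add, ← h1, h.sq_add_sq]
    · rintro ⟨p, hp, rfl⟩
      refine ⟨y (y ⟨p, hp⟩), ?_⟩
      have h1 := hx ⟨p, hp⟩
      rw [← h1]
      exact h.pair.sq.mem_graph.2 (h.pair.sq.comm _).symm
  · rw [← wedge_one fun _ => p, hJ, wedge_one]
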